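/- Let $d\ge 2$, and for $u\in\mathbb Z^d$ write $x(u)=u_1$, $y(u)=u_2$. A walk of length $n\ge 0$ is a nearest-neighbour map $\gamma:\{0,\dots,n\}\to\mathbb Z^d$, and $|\gamma|=n$ is its length; it is self-avoiding if it is injective. Let $\mathrm{SAW}_n$ be the set of self-avoiding walks of length $n$ with $\gamma_0=0$ and let $\mu_c=\lim_n|\mathrm{SAW}_n|^{1/n}$ be the connective constant. A (self-avoiding) bridge is a self-avoiding walk $\gamma$ of some length $n$ with $y(\gamma_0)<y(\gamma_j)$ for $1\le j\le n$ and $y(\gamma_j)\le y(\gamma_n)$ for $0\le j\le n$; an infinite bridge is an infinite self-avoiding walk $(\gamma_j)_{j\ge0}$ with $y(\gamma_0)<y(\gamma_j)$ for all $j\ge 1$. A bridge $\gamma$ of length $n\ge1$ is irreducible if there is no $1\le k\le n-1$ for which both $\gamma[0,k]$ and $\gamma[k,n]$ are bridges. Let $\mathrm{iSAB}$ be the set of irreducible bridges starting at $0$, let $\mathbb P_{\mathrm{iSAB}}$ be the probability measure on $\mathrm{iSAB}$ with $\mathbb P_{\mathrm{iSAB}}(\gamma)=\mu_c^{-|\gamma|}$,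 and let $\mathbb P_{\mathrm{iSAB}}^{\otimes\mathbb N}$ be the law of the infinite walk obtained by concatenating infinitely many independent samples of $\mathbb P_{\mathrm{iSAB}}$. For an infinite walk $\gamma=(\gamma_j)_{j\ge 0}$, let $\mathsf R_\gamma$ be the set of indices $i$ of renewal points, that is, those for which $\gamma[0,i]$ is a bridge and $\gamma[i,\infty)$ is an infinite bridge; let $\mathbf r_0=0$ and $\mathbf r_{k+1}=\inf\{j>\mathbf r_k: j\in\mathsf R_\gamma\}$. Let $\mathsf D_\gamma$ be the set of indices $i$ of diamond points, that is, those for which $(x+y)(\gamma_j)\ge(x+y)(\gamma_i)$ and $(y-x)(\gamma_j)\ge(y-x)(\gamma_i)$ for all $j\ge i$, and $(x+y)(\gamma_j)\le(x+y)(\gamma_i)$ and $(y-x)(\gamma_j)\le(y-x)(\gamma_i)$ for all $0\le j\le i$. **Proposition.** If $\mathbb E_{\mathrm{iSAB}}(|\gamma|)<\infty$, then there exists $\delta>0$ such that $$\mathbb P_{\mathrm{iSAB}}^{\otimes\mathbb N}\left(\liminf_{n\to\infty}\frac{|\mathsf D_\gamma\cap\mathsf R_\gamma\cap[0,\mathbf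 r_n]|}{n}\ge\delta\right)=1 .$$ -/

import Mathlib

open MeasureTheory Filter
open scoped ENNReal

namespace SelfAvoiding

/-- The vertices of the integer lattice `ℤ^d`. -/
abbrev Lattice (d : ℕ) : Type := Fin d → ℤ

/-- Nearest-neighbour adjacency in `ℤ^d`. -/
def Adj {d : ℕ} (u v : Lattice d) : Prop := ∑ i, |u i - v i| = 1

/-- The first coordinate. -/
def xCoord {d : ℕ} [NeZero d] (u : Lattice d) : ℤ := u 0

/-- The second coordinate (it is only used when `2 ≤ d`). -/
def yCoord {d : ℕ} [NeZero d] (u : Lattice d) : ℤ := u 1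

/-- A walk of finite length `n`, that is, a nearest-neighbour map `{0, …, n} → ℤ^d`.  The map is
recorded as a function on `ℕ` that is constant from time `n` on, so that two walks are equal
exactly when they have the same length and visit the same vertices at the times `0, …, n`. -/
@[ext]
structure FinWalk (d : ℕ) where
  /-- The number of edges. -/
  length : ℕ
  /-- The vertex at each time. -/
  path : ℕ → Lattice d
  adj : ∀ i < length, Adj (path i) (path (i + 1))
  stopped : ∀ k, length ≤ k → path k = path length

/-- `SAW_n`: the self-avoiding walks of length `n` that start at the origin. -/
def SAW (d n : ℕ) : Set (FinWalk d) :=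
  {γ | γ.length = n ∧ γ.path 0 = 0 ∧ Set.InjOn γ.path (Set.Iic n)}

/-- The connective constant `μ_c = lim_n |SAW_n|^{1/n}`. -/
noncomputable def connectiveConstant (d : ℕ) : ℝ :=
  limUnder atTop fun n : ℕ => ((SAW d n).ncard : ℝ) ^ (1 / (n : ℝ))

section Bridges

variable {d : ℕ} [NeZero d]

/-- The part `γ[a, b]` of `γ` is a self-avoiding bridge: it is a self-avoiding walk, its first
vertex is its only vertex of minimal second coordinate, and its last vertex has maximal second
coordinate. -/
def IsBridgeOn (γ : ℕ → Lattice d) (a b : ℕ) : Prop :=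
  a ≤ b ∧
  (∀ i, a ≤ i → i < b → Adj (γ i) (γ (i + 1))) ∧
  Set.InjOn γ (Set.Icc a b) ∧
  (∀ j ∈ Set.Ioc a b, yCoord (γ a) < yCoord (γ j)) ∧
  (∀ j ∈ Set.Icc a b, yCoord (γ j) ≤ yCoord (γ b))

/-- The part `γ[a, ∞)` of `γ` is an infinite self-avoiding bridge: it is a self-avoiding walk
whose first vertex is its only vertex of minimal second coordinate. -/
def IsInfBridgeFrom (γ : ℕ → Lattice d) (a : ℕ) : Prop :=
  (∀ i, a ≤ i → Adj (γ i) (γ (i + 1))) ∧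
  Set.InjOn γ (Set.Ici a) ∧
  (∀ j ∈ Set.Ioi a, yCoord (γ a) < yCoord (γ j))

/-- A finite walk is an irreducible bridge: it is a bridge of length at least one, and no vertex
other than its endpoints is a renewal point, a renewal point being one that splits the bridge
into two bridges. -/
def FinWalk.IsIrreducibleBridge (γ : FinWalk d) : Prop :=
  1 ≤ γ.length ∧ IsBridgeOn γ.path 0 γ.length ∧
  ∀ k, 1 ≤ k → k + 1 ≤ γ.length →
    ¬ (IsBridgeOn γ.path 0 k ∧ IsBridgeOn γ.path k γ.length)

/-- The times at which an infinite walk is at a renewal point. -/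
def renewalTimes (γ : ℕ → Lattice d) : Set ℕ :=
  {i | IsBridgeOn γ 0 i ∧ IsInfBridgeFrom γ i}

/-- The times at which an infinite walk is at a diamond point. -/
def diamondTimes (γ : ℕ → Lattice d) : Set ℕ :=
  {i | (∀ j, i ≤ j →
          xCoord (γ i) + yCoord (γ i) ≤ xCoord (γ j) + yCoord (γ j) ∧
          yCoord (γ i) - xCoord (γ i) ≤ yCoord (γ j) - xCoord (γ j)) ∧
       (∀ j, j ≤ i →
          xCoord (γ j) + yCoord (γ j) ≤ xCoord (γ i) + yCoord (γ i) ∧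
          yCoord (γ j) - xCoord (γ j) ≤ yCoord (γ i) - xCoord (γ i))}

/-- The successive renewal times `r_0 = 0`, `r_{k+1} = inf {j > r_k : γ_j is a renewal point}`. -/
noncomputable def renewalIndex (γ : ℕ → Lattice d) : ℕ → ℕ
  | 0 => 0
  | k + 1 => sInf {j | renewalIndex γ k < j ∧ j ∈ renewalTimes γ}

end Bridges

/-- `iSAB`: the irreducible bridges that start at the origin. -/
def ISAB (d : ℕ) [NeZero d] : Type :=
  {γ : FinWalk d // γ.IsIrreducibleBridge ∧ γ.path 0 = 0}

section Law

variable {d : ℕ} [NeZero d]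

/-- The length of an irreducible bridge. -/
def ISAB.length (γ : ISAB d) : ℕ := γ.1.length

/-- The vertices of an irreducible bridge (constant after its last time). -/
def ISAB.path (γ : ISAB d) : ℕ → Lattice d := γ.1.path

instance : MeasurableSpace (ISAB d) := ⊤

/-- The law on irreducible bridges with `P(γ) = μ_c^{-|γ|}`. -/
noncomputable def iSABLaw (d : ℕ) [NeZero d] : Measure (ISAB d) :=
  Measure.sum fun γ : ISAB d =>
    ENNReal.ofReal ((connectiveConstant d ^ γ.length)⁻¹) • Measure.dirac γ

/-- The time at which the `n`-th block of a concatenation starts. -/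
def blockStart (ξ : ℕ → ISAB d) (n : ℕ) : ℕ := ∑ i ∈ Finset.range n, (ξ i).length

/-- The infinite concatenation of a sequence of irreducible bridges.  At time `k`, a block that
starts at time `s` has contributed the displacement `(ξ i).path (k - s)`: it is zero if the block
has not started yet (`k ≤ s`, truncated subtraction), and the total displacement of the block if
the block is over.  Blocks have positive length, so only the first `k` of them matter. -/
def concat (ξ : ℕ → ISAB d) (k : ℕ) : Lattice d :=
  ∑ i ∈ Finset.range k, (ξ i).path (k - blockStart ξ i)

/-- The law on infinite walks obtained by concatenating independent samples of `iSABLaw`. -/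
noncomputable def infiniteBridgeLaw (d : ℕ) [NeZero d] : Measure (ℕ → Lattice d) :=
  (Measure.infinitePi fun _ : ℕ => iSABLaw d).map concat

theorem ISAB.path_zero (γ : ISAB d) : γ.path 0 = 0 := γ.2.2

theorem ISAB.one_le_length (γ : ISAB d) : 1 ≤ γ.length := γ.2.1.1

theorem le_blockStart (ξ : ℕ → ISAB d) (n : ℕ) : n ≤ blockStart ξ n := by
  induction n with
  | zero => exact Nat.zero_le _
  | succ n ih =>
    have h := (ξ n).one_le_length
    unfold blockStart at *
    rw [Finset.sum_range_succ]
    omega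

theorem blockStart_mono (ξ : ℕ → ISAB d) : Monotone (blockStart ξ) := fun _ _ h =>
  Finset.sum_le_sum_of_subset (Finset.range_mono h)

/-- A check of the definition of `concat`: at time `blockStart ξ n + j` with `j` at most the
length of the `n`-th block, the walk is at the sum of the displacements of the first `n` blocks
plus the position at time `j` of the `n`-th block. -/
theorem concat_blockStart_add (ξ : ℕ → ISAB d) (n j : ℕ) (hj : j ≤ (ξ n).length) :
    concat ξ (blockStart ξ n + j) =
      (∑ i ∈ Finset.range n, (ξ i).path (ξ i).length) + (ξ n).path j := by
  have hsucc : ∀ m, blockStart ξ (m + 1) = blockStart ξ m + (ξ m).length := fun m =>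
    Finset.sum_range_succ _ _
  have hbig : ∀ i, n + 1 ≤ i → (ξ i).path (blockStart ξ n + j - blockStart ξ i) = 0 := by
    intro i hi
    have h1 := blockStart_mono ξ hi
    have h2 := hsucc n
    rw [Nat.sub_eq_zero_of_le (by omega)]
    exact (ξ i).path_zero
  have key : concat ξ (blockStart ξ n + j) =
      ∑ i ∈ Finset.range (n + 1), (ξ i).path (blockStart ξ n + j - blockStart ξ i) := by
    have hn := le_blockStart ξ n
    rcases Nat.lt_or_ge n (blockStart ξ n + j) with h | h
    · symm
      refine Finset.sum_subset (Finset.range_mono h) fun i _ hi => hbig i ?_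
      simpa using hi
    · have hj0 : j = 0 := by omega
      have hnn : blockStart ξ n = n := by omega
      subst hj0
      rw [Finset.sum_range_succ]
      simp [concat, hnn, ISAB.path_zero]
  rw [key, Finset.sum_range_succ]
  congr 1
  · refine Finset.sum_congr rfl fun i hi => ?_
    have h1 := blockStart_mono ξ (Nat.succ_le_of_lt (Finset.mem_range.1 hi))
    have h2 := hsucc i
    exact (ξ i).1.stopped _ (by change (ξ i).length ≤ _; simp only [Nat.succ_eq_add_one] at h1; omega)
  · rw [Nat.add_sub_cancel_left]

theorem measurable_concat : Measurable (concat : (ℕ → ISAB d) → ℕ → Lattice d) := by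
  refine measurable_pi_lambda _ fun k => ?_
  unfold concat
  refine Finset.measurable_sum _ fun i _ => ?_
  have hs : Measurable fun ξ : ℕ → ISAB d => k - blockStart ξ i := by
    have : Measurable fun ξ : ℕ → ISAB d => blockStart ξ i := by
      unfold blockStart
      exact Finset.measurable_sum _ fun m _ =>
        (measurable_from_top (f := ISAB.length)).comp (measurable_pi_apply m)
    exact (measurable_from_top (f := fun s : ℕ => k - s)).comp this
  have hp : Measurable fun p : ISAB d × ℕ => p.1.path p.2 :=
    measurable_from_prod_countable_left fun _ => measurable_from_top
  exact hp.comp ((measurable_pi_apply i).prodMk hs)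

end Law

end SelfAvoiding

/-! ### Adjacency and reflections -/

namespace SelfAvoiding

/-! The blocks of the infinite walk are i.i.d., and its renewal times are exactly the block
boundaries (`renewalTimes_concat`), so the n-th renewal time is the start of block n. It remains to
show that a positive fraction of block boundaries are diamond points.

Extend the blocks to an i.i.d. sequence indexed by ℤ. The event `diamondSet` asks that, seen from
the origin, the future blocks stay in the cone y ± x ≥ 0 and the past blocks in the opposite cone.
If the sequence shifted by n lies in it, boundary n is a diamond point of the one-sided walk
(`blockStart_mem_diamondTimes`). The indicator is now evaluated along the orbit of an ergodic shift
(`ergodic_shift`). With p half the probability of the event, p minus the indicator has negative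
mean, so its Birkhoff sums are almost surely bounded above (`ae_bddAbove_birkhoffSum`, from the
maximal ergodic theorem). Hence there are at least pn - C diamond boundaries among the first n,
which gives the liminf bound.

Positivity of the probability (`measure_diamondSet_pos`): reflection in x makes the mean of y ± x
over a block positive, and finite mean length makes the length of block k of order o(k). By the law
of large numbers each half of the walk leaves its cone by a finite amount, hence with positive
probability by at most some fixed M. Placing M single upward steps on each side of the origin, an
independent event of positive probability, absorbs this defect.

All of this needs the weights of irreducible bridges to form a probability measure, which is
Kesten's relation (`genFun_irreducibleSet_criticalPoint`). The Hammersley–Welsh decomposition makes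
the bridge generating function infinite at 1/μ_c, and the renewal equation for bridges turns this
into total mass one. -/

theorem adj_add_right {d : ℕ} {u v : Lattice d} (w : Lattice d) :
    Adj (u + w) (v + w) ↔ Adj u v := by
  simp [Adj]

theorem adj_add_left {d : ℕ} {u v : Lattice d} (w : Lattice d) :
    Adj (w + u) (w + v) ↔ Adj u v := by
  simp [Adj]

theorem Adj.symm {d : ℕ} {u v : Lattice d} (h : Adj u v) : Adj v u := by
  unfold Adj at *
  rw [← h]
  exact Finset.sum_congr rfl fun i _ => abs_sub_comm _ _

theorem Adj.abs_sub_le_one {d : ℕ} {u v : Lattice d} (h : Adj u v) (i : Fin d) :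
    |u i - v i| ≤ 1 :=
  h ▸ Finset.single_le_sum (f := fun i => |u i - v i|) (fun _ _ => abs_nonneg _)
    (Finset.mem_univ i)

theorem abs_sub_le_of_adj {d : ℕ} {γ : ℕ → Lattice d} {a n : ℕ}
    (h : ∀ i < n, Adj (γ (a + i)) (γ (a + i + 1))) (c : Fin d) :
    |γ (a + n) c - γ a c| ≤ n := by
  induction n with
  | zero => simp
  | succ n ih =>
    have h1 := ih fun i hi => h i (by omega)
    have h2 := (h n (by omega)).abs_sub_le_one c
    rw [abs_le] at *
    push_cast
    rw [← add_assoc]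
    omega

/-- The reflection of the `c`-th coordinate. -/
def reflect {d : ℕ} (c : Fin d) (u : Lattice d) : Lattice d := fun i => if i = c then -u i else u i

@[simp] theorem reflect_reflect {d : ℕ} (c : Fin d) (u : Lattice d) :
    reflect c (reflect c u) = u := by
  ext i; simp only [reflect]; split_ifs <;> simp

theorem reflect_injective {d : ℕ} (c : Fin d) : Function.Injective (reflect (d := d) c) :=
  Function.Involutive.injective (reflect_reflect c)

@[simp] theorem reflect_zero {d : ℕ} (c : Fin d) : reflect c (0 : Lattice d) = 0 := by
  ext i; simp [reflect]

theorem reflect_same {d : ℕ} (c : Fin d) (u : Lattice d) : reflect c u c = -u c := by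
  simp [reflect]

theorem reflect_ne {d : ℕ} {c i : Fin d} (u : Lattice d) (h : i ≠ c) : reflect c u i = u i := by
  simp [reflect, h]

theorem adj_reflect {d : ℕ} {c : Fin d} {u v : Lattice d} (h : Adj u v) :
    Adj (reflect c u) (reflect c v) := by
  unfold Adj at *
  rw [← h]
  refine Finset.sum_congr rfl fun i _ => ?_
  simp only [reflect]
  split_ifs
  · rw [← abs_neg]; congr 1; ring
  · rfl

/-! ### Cutting, reversing, reflecting and joining finite walks -/

namespace FinWalk

variable {d : ℕ}

/-- The first `n` steps of a walk. -/
def take (γ : FinWalk d) (n : ℕ) : FinWalk d where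
  length := min n γ.length
  path k := γ.path (min k n)
  adj i hi := by
    rw [min_eq_left (by omega), min_eq_left (by omega)]
    exact γ.adj i (by omega)
  stopped k hk := by
    rcases le_total n γ.length with h | h
    · congr 1; omega
    · rw [γ.stopped (min k n) (by omega), γ.stopped (min _ n) (by omega)]

/-- A walk without its first `n` steps, translated to start at the origin. -/
def drop (γ : FinWalk d) (n : ℕ) : FinWalk d where
  length := γ.length - n
  path k := γ.path (n + k) - γ.path n
  adj i hi := by
    simp only [sub_eq_add_neg]
    rw [adj_add_right]
    exact γ.adj (n + i) (by omega)
  stopped k hk := by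
    rw [γ.stopped (n + k) (by omega), γ.stopped (n + (γ.length - n)) (by omega)]

/-- The time reversal of a walk, translated to start at the origin. -/
def rev (γ : FinWalk d) : FinWalk d where
  length := γ.length
  path k := γ.path (γ.length - k) - γ.path γ.length
  adj i hi := by
    simp only [sub_eq_add_neg]
    rw [adj_add_right]
    have := γ.adj (γ.length - (i + 1)) (by omega)
    rw [show γ.length - (i + 1) + 1 = γ.length - i by omega] at this
    exact this.symm
  stopped k hk := by
    congr 2; omega

/-- The reflection of a walk. -/
def refl (c : Fin d) (γ : FinWalk d) : FinWalk d where
  length := γ.length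
  path k := reflect c (γ.path k)
  adj i hi := adj_reflect (γ.adj i hi)
  stopped k hk := by rw [γ.stopped k hk]

/-- The concatenation of two walks, the second one being translated. -/
def append (γ η : FinWalk d) : FinWalk d where
  length := γ.length + η.length
  -- Outside its own time window each factor is constant, by `stopped` on one side and truncated
  -- subtraction on the other, so one formula covers both pieces.
  path k := γ.path k + (η.path (k - γ.length) - η.path 0)
  adj i hi := by
    rcases lt_or_ge i γ.length with h | h
    · rw [Nat.sub_eq_zero_of_le h.le, Nat.sub_eq_zero_of_le h, adj_add_right]
      exact γ.adj i h
    · rw [γ.stopped i h, γ.stopped (i + 1) (by omega), adj_add_left]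
      simp only [sub_eq_add_neg (η.path _)]
      rw [adj_add_right, show i + 1 - γ.length = i - γ.length + 1 by omega]
      exact η.adj _ (by omega)
  stopped k hk := by
    rw [γ.stopped k (by omega), γ.stopped (γ.length + η.length) (by omega),
      η.stopped (k - γ.length) (by omega), Nat.add_sub_cancel_left]

theorem append_path_of_le (γ η : FinWalk d) {k : ℕ} (h : k ≤ γ.length) :
    (γ.append η).path k = γ.path k := by
  simp [append, Nat.sub_eq_zero_of_le h]

theorem append_path_add (γ η : FinWalk d) (k : ℕ) :
    (γ.append η).path (γ.length + k) = γ.path γ.length + (η.path k - η.path 0) := by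
  simp [append, γ.stopped (γ.length + k) (by omega)]

theorem drop_append (γ η : FinWalk d) (h : η.path 0 = 0) : (γ.append η).drop γ.length = η := by
  ext1
  · simp [drop, append]
  · funext k
    change (γ.append η).path _ - (γ.append η).path _ = _
    rw [append_path_add, append_path_of_le _ _ le_rfl, h]
    simp

theorem take_append (γ η : FinWalk d) : (γ.append η).take γ.length = γ := by
  ext1
  · simp [take, append]
  · funext k
    change (γ.append η).path _ = _
    rw [append_path_of_le _ _ (min_le_right _ _)]
    rcases le_total k γ.length with h | h
    · rw [min_eq_left h]
    · rw [min_eq_right h, γ.stopped k h]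

theorem append_take_drop (γ : FinWalk d) {n : ℕ} (h : n ≤ γ.length) :
    (γ.take n).append (γ.drop n) = γ := by
  ext1
  · simp [take, drop, append]; omega
  · funext k
    simp only [append, take, drop, min_eq_left h]
    rcases le_total k n with h' | h'
    · simp [Nat.sub_eq_zero_of_le h', h']
    · rw [Nat.add_sub_cancel' h', min_eq_right h']; simp

theorem rev_rev (γ : FinWalk d) (h : γ.path 0 = 0) : γ.rev.rev = γ := by
  ext1
  · rfl
  · funext k
    simp only [rev, Nat.sub_self, h]
    rcases le_total k γ.length with h' | h'
    · rw [Nat.sub_sub_self h']; simp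
    · rw [Nat.sub_eq_zero_of_le h', γ.stopped k h']; simp

theorem refl_refl (c : Fin d) (γ : FinWalk d) : (γ.refl c).refl c = γ := by
  ext1
  · rfl
  · funext k; simp [refl]

/-- Walks that agree up to their common length are equal. -/
theorem ext_of_le {γ η : FinWalk d} (h : γ.length = η.length)
    (h' : ∀ k ≤ γ.length, γ.path k = η.path k) : γ = η := by
  ext1
  · exact h
  · funext k
    rcases le_total k γ.length with hk | hk
    · exact h' k hk
    · rw [γ.stopped k hk, η.stopped k (h ▸ hk), ← h, h' _ le_rfl]

theorem abs_path_sub_le (γ : FinWalk d) {i j : ℕ} (hij : i ≤ j) (hj : j ≤ γ.length) (c : Fin d) :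
    |γ.path j c - γ.path i c| ≤ (j - i : ℕ) := by
  have := abs_sub_le_of_adj (γ := γ.path) (a := i) (n := j - i)
    (fun k hk => γ.adj (i + k) (by omega)) c
  rwa [Nat.add_sub_cancel' hij] at this

end FinWalk

/-! ### Translation, gluing and restriction of bridges -/

section Bridge

variable {d : ℕ} [NeZero d]

@[simp] theorem yCoord_zero : yCoord (0 : Lattice d) = 0 := rfl
theorem yCoord_add (u v : Lattice d) : yCoord (u + v) = yCoord u + yCoord v := rfl
theorem yCoord_sub (u v : Lattice d) : yCoord (u - v) = yCoord u - yCoord v := rfl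
theorem yCoord_reflect (u : Lattice d) : yCoord (reflect 1 u) = -yCoord u := reflect_same _ _

theorem isBridgeOn_refl (γ : ℕ → Lattice d) (a : ℕ) : IsBridgeOn γ a a := by
  refine ⟨le_rfl, fun i h h' => by omega, by simp, by simp, by simp⟩

theorem IsBridgeOn.of_shift {γ γ' : ℕ → Lattice d} {a a' n : ℕ} (w : Lattice d)
    (h : ∀ k ≤ n, γ' (a' + k) = γ (a + k) + w) (hb : IsBridgeOn γ a (a + n)) :
    IsBridgeOn γ' a' (a' + n) := by
  obtain ⟨-, h1, h2, h3, h4⟩ := hb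
  have h' : ∀ i, a' ≤ i → i ≤ a' + n → γ' i = γ (a + (i - a')) + w := fun i hi hi' => by
    rw [← h (i - a') (by omega), Nat.add_sub_cancel' hi]
  refine ⟨by omega, fun i hi hi' => ?_, ?_, fun j hj => ?_, fun j hj => ?_⟩
  · rw [h' i hi (by omega), h' (i + 1) (by omega) (by omega), adj_add_right,
      show a + (i + 1 - a') = a + (i - a') + 1 by omega]
    exact h1 _ (by omega) (by omega)
  · intro i hi j hj hij
    rw [Set.mem_Icc] at hi hj
    rw [h' i hi.1 hi.2, h' j hj.1 hj.2, add_left_inj] at hij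
    have := h2 (Set.mem_Icc.2 ⟨by omega, by omega⟩) (Set.mem_Icc.2 ⟨by omega, by omega⟩) hij
    omega
  · rw [Set.mem_Ioc] at hj
    rw [h' a' le_rfl (by omega), h' j (by omega) hj.2, yCoord_add, yCoord_add]
    have := h3 (a + (j - a')) (Set.mem_Ioc.2 ⟨by omega, by omega⟩)
    simpa using this
  · rw [Set.mem_Icc] at hj
    rw [h' j hj.1 hj.2, h' (a' + n) (by omega) le_rfl, yCoord_add, yCoord_add]
    have := h4 (a + (j - a')) (Set.mem_Icc.2 ⟨by omega, by omega⟩)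
    simpa using this

theorem isBridgeOn_shift {γ γ' : ℕ → Lattice d} {a a' n : ℕ} (w : Lattice d)
    (h : ∀ k ≤ n, γ' (a' + k) = γ (a + k) + w) :
    IsBridgeOn γ a (a + n) ↔ IsBridgeOn γ' a' (a' + n) :=
  ⟨.of_shift w h, .of_shift (-w) fun k hk => by rw [h k hk]; simp⟩

/-- The first piece stays at or below the level of time b and the second is strictly above it
afterwards, so the two cannot meet. -/
theorem IsBridgeOn.trans {γ : ℕ → Lattice d} {a b c : ℕ} (h : IsBridgeOn γ a b)
    (h' : IsBridgeOn γ b c) : IsBridgeOn γ a c := by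
  obtain ⟨hab, h1, h2, h3, h4⟩ := h
  obtain ⟨hbc, h1', h2', h3', h4'⟩ := h'
  have hy : yCoord (γ a) ≤ yCoord (γ b) := h4 a ⟨le_rfl, hab⟩
  have hy' : yCoord (γ b) ≤ yCoord (γ c) := h4' b ⟨le_rfl, hbc⟩
  refine ⟨hab.trans hbc, fun i hi hi' => ?_, ?_, fun j hj => ?_, fun j hj => ?_⟩
  · rcases lt_or_ge i b with hib | hib
    · exact h1 i hi hib
    · exact h1' i hib hi'
  · have key : ∀ i j, a ≤ i → i ≤ b → b < j → j ≤ c → γ i ≠ γ j := fun i j hi hi' hj hj' hij => by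
      have e1 := h4 i ⟨hi, hi'⟩
      have e2 := h3' j ⟨hj, hj'⟩
      rw [hij] at e1
      omega
    intro i hi j hj hij
    rw [Set.mem_Icc] at hi hj
    rcases le_or_gt i b with hib | hib <;> rcases le_or_gt j b with hjb | hjb
    · exact h2 ⟨hi.1, hib⟩ ⟨hj.1, hjb⟩ hij
    · exact absurd hij (key i j hi.1 hib hjb hj.2)
    · exact absurd hij.symm (key j i hj.1 hjb hib hi.2)
    · exact h2' ⟨hib.le, hi.2⟩ ⟨hjb.le, hj.2⟩ hij
  · rw [Set.mem_Ioc] at hj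
    rcases le_or_gt j b with hjb | hjb
    · exact h3 j ⟨hj.1, hjb⟩
    · exact hy.trans_lt (h3' j ⟨hjb, hj.2⟩)
  · rw [Set.mem_Icc] at hj
    rcases le_or_gt j b with hjb | hjb
    · exact (h4 j ⟨hj.1, hjb⟩).trans hy'
    · exact h4' j ⟨hjb.le, hj.2⟩

theorem IsBridgeOn.restrict_left {γ : ℕ → Lattice d} {a b c : ℕ} (h : IsBridgeOn γ a c)
    (hab : a ≤ b) (hbc : b ≤ c) (hb : ∀ j ∈ Set.Ioc b c, yCoord (γ b) < yCoord (γ j)) :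
    IsBridgeOn γ b c := by
  obtain ⟨-, h1, h2, h3, h4⟩ := h
  exact ⟨hbc, fun i hi => h1 i (hab.trans hi), h2.mono (Set.Icc_subset_Icc_left hab), hb,
    fun j hj => h4 j ⟨hab.trans hj.1, hj.2⟩⟩

theorem IsBridgeOn.restrict_right {γ : ℕ → Lattice d} {a b c : ℕ} (h : IsBridgeOn γ a c)
    (hab : a ≤ b) (hbc : b ≤ c) (hb : ∀ j ∈ Set.Icc a b, yCoord (γ j) ≤ yCoord (γ b)) :
    IsBridgeOn γ a b := by
  obtain ⟨-, h1, h2, h3, h4⟩ := h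
  exact ⟨hab, fun i hi hi' => h1 i hi (hi'.trans_le hbc), h2.mono (Set.Icc_subset_Icc_right hbc),
    fun j hj => h3 j ⟨hj.1, hj.2.trans hbc⟩, hb⟩

theorem isBridgeOn_congr {γ γ' : ℕ → Lattice d} {a b : ℕ}
    (h : ∀ k, a ≤ k → k ≤ b → γ' k = γ k) : IsBridgeOn γ a b ↔ IsBridgeOn γ' a b := by
  by_cases hab : a ≤ b
  · obtain ⟨n, rfl⟩ := Nat.exists_eq_add_of_le hab
    exact isBridgeOn_shift 0 fun k hk => by rw [h _ (by omega) (by omega), add_zero]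
  · exact ⟨fun h => absurd h.1 hab, fun h => absurd h.1 hab⟩

theorem FinWalk.isBridgeOn_take (γ : FinWalk d) {a b n : ℕ} (hb : b ≤ n) :
    IsBridgeOn (γ.take n).path a b ↔ IsBridgeOn γ.path a b :=
  isBridgeOn_congr fun k _ hk => by simp [FinWalk.take, hk.trans hb]

theorem FinWalk.isBridgeOn_drop (γ : FinWalk d) {a b n : ℕ} :
    IsBridgeOn (γ.drop n).path a b ↔ IsBridgeOn γ.path (n + a) (n + b) := by
  by_cases hab : a ≤ b
  · obtain ⟨m, rfl⟩ := Nat.exists_eq_add_of_le hab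
    rw [← add_assoc]
    exact isBridgeOn_shift (γ.path n) fun k hk => by simp [FinWalk.drop, add_assoc]
  · exact ⟨fun h => absurd h.1 hab, fun h => absurd h.1 (by omega)⟩

theorem FinWalk.isBridgeOn_append_left (γ η : FinWalk d) {a b : ℕ} (hb : b ≤ γ.length) :
    IsBridgeOn (γ.append η).path a b ↔ IsBridgeOn γ.path a b :=
  isBridgeOn_congr fun k _ hk => by rw [γ.append_path_of_le η (hk.trans hb)]

theorem FinWalk.isBridgeOn_append_right (γ η : FinWalk d) {b : ℕ} :
    IsBridgeOn (γ.append η).path γ.length (γ.length + b) ↔ IsBridgeOn η.path 0 b := by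
  rw [← zero_add b, ← add_assoc]
  exact isBridgeOn_shift (η.path 0 - γ.path γ.length) fun k hk => by
    rw [γ.append_path_add η, zero_add]; abel

end Bridge

/-! ### Generating functions of sets of walks -/

section GeneratingFunction

variable {d : ℕ}

/-- The generating function of a set of walks. -/
noncomputable def genFun (z : ℝ≥0∞) (S : Set (FinWalk d)) : ℝ≥0∞ :=
  ∑' γ : S, z ^ γ.1.length

theorem genFun_mono (z : ℝ≥0∞) {S T : Set (FinWalk d)} (h : S ⊆ T) : genFun z S ≤ genFun z T :=
  ENNReal.tsum_mono_subtype (fun γ : FinWalk d => z ^ γ.length) h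

theorem genFun_union_le (z : ℝ≥0∞) (S T : Set (FinWalk d)) :
    genFun z (S ∪ T) ≤ genFun z S + genFun z T :=
  ENNReal.tsum_union_le (fun γ : FinWalk d => z ^ γ.length) S T

theorem genFun_mul (z : ℝ≥0∞) (A B : Set (FinWalk d)) :
    genFun z A * genFun z B = ∑' p : A × B, z ^ (p.1.1.length + p.2.1.length) := by
  rw [ENNReal.tsum_prod', genFun, ← ENNReal.tsum_mul_right]
  refine tsum_congr fun p => ?_
  rw [genFun, ← ENNReal.tsum_mul_left]
  exact tsum_congr fun q => (pow_add _ _ _).symm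

/-- A way of cutting walks into pairs is injective as soon as `J` recovers the walk from its pieces;
additivity of lengths makes the weights multiply. -/
theorem genFun_le_mul (z : ℝ≥0∞) {S A B : Set (FinWalk d)}
    (J : FinWalk d → FinWalk d → FinWalk d)
    (h : ∀ γ ∈ S, ∃ p ∈ A, ∃ q ∈ B, J p q = γ ∧ γ.length = p.length + q.length) :
    genFun z S ≤ genFun z A * genFun z B := by
  choose! p hp q hq hJ hl using h
  rw [genFun_mul]
  let f : S → A × B := fun γ => (⟨p γ, hp γ γ.2⟩, ⟨q γ, hq γ γ.2⟩)
  have hf : Function.Injective f := fun γ η h => by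
    have h1 : p γ = p η := congrArg (fun x => x.1.1) h
    have h2 : q γ = q η := congrArg (fun x => x.2.1) h
    apply Subtype.ext
    rw [← hJ γ γ.2, ← hJ η η.2, h1, h2]
  refine le_trans (ENNReal.tsum_le_tsum fun γ => ?_)
    (ENNReal.tsum_comp_le_tsum_of_injective hf _)
  rw [hl γ γ.2]

theorem mul_genFun_le (z : ℝ≥0∞) {S A B : Set (FinWalk d)}
    (J : FinWalk d → FinWalk d → FinWalk d)
    (h : ∀ p ∈ A, ∀ q ∈ B, J p q ∈ S ∧ (J p q).length = p.length + q.length)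
    (hinj : ∀ p ∈ A, ∀ q ∈ B, ∀ p' ∈ A, ∀ q' ∈ B, J p q = J p' q' → p = p' ∧ q = q') :
    genFun z A * genFun z B ≤ genFun z S := by
  rw [genFun_mul]
  let f : A × B → S := fun x => ⟨J x.1 x.2, (h x.1 x.1.2 x.2 x.2.2).1⟩
  have hf : Function.Injective f := fun x y hxy => by
    have := hinj x.1 x.1.2 x.2 x.2.2 y.1 y.1.2 y.2 y.2.2 (congrArg Subtype.val hxy)
    exact Prod.ext (Subtype.ext this.1) (Subtype.ext this.2)
  refine le_trans (ENNReal.tsum_le_tsum fun x => ?_)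
    (ENNReal.tsum_comp_le_tsum_of_injective hf _)
  exact (congrArg (z ^ ·) (h x.1 x.1.2 x.2 x.2.2).2.symm).le

theorem genFun_singleton (z : ℝ≥0∞) (γ : FinWalk d) : genFun z {γ} = z ^ γ.length := by
  rw [genFun, tsum_singleton γ (fun γ : FinWalk d => z ^ γ.length)]

theorem sum_genFun_le (z : ℝ≥0∞) {ι : Type*} (s : Finset ι) {S : ι → Set (FinWalk d)}
    {T : Set (FinWalk d)} (h : ∀ i ∈ s, S i ⊆ T)
    (hd : (s : Set ι).PairwiseDisjoint S) : ∑ i ∈ s, genFun z (S i) ≤ genFun z T := by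
  have := Summable.tsum_finset_bUnion_disjoint (f := fun γ : FinWalk d => z ^ γ.length) hd
    (fun _ _ => ENNReal.summable)
  unfold genFun
  rw [← this]
  exact genFun_mono z (Set.iUnion₂_subset h)

/-- A generating function is bounded as soon as those of the sets in an exhaustion are. -/
theorem genFun_le_of_exhaustion (z : ℝ≥0∞) {S : Set (FinWalk d)} {T : ℕ → Set (FinWalk d)}
    {C : ℝ≥0∞} (hT : Monotone T) (h : ∀ γ ∈ S, ∃ n, γ ∈ T n) (hC : ∀ n, genFun z (T n) ≤ C) :
    genFun z S ≤ C := by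
  have hS : S ⊆ ⋃ n, T n := fun γ hγ => Set.mem_iUnion.2 (h γ hγ)
  refine (genFun_mono z hS).trans ?_
  -- The generating function is the counting measure with density z^length, so this is continuity of
  -- a measure from below.
  have : genFun z (⋃ n, T n) = ⨆ n, genFun z (T n) := by
    let _ : MeasurableSpace (FinWalk d) := ⊤
    have e : ∀ A : Set (FinWalk d), genFun z A =
        (Measure.count.withDensity fun γ : FinWalk d => z ^ γ.length) A := fun A => by
      rw [withDensity_apply _ MeasurableSpace.measurableSet_top,
        ← lintegral_indicator MeasurableSpace.measurableSet_top, lintegral_count,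
        genFun, tsum_subtype A (fun γ : FinWalk d => z ^ γ.length)]
    simp only [e]
    exact hT.measure_iUnion
  rw [this]
  exact iSup_le hC

theorem prod_one_add_le_exp {ι : Type*} (s : Finset ι) (x : ι → ℝ≥0∞) {C : ℝ≥0∞} (hC : C ≠ ⊤)
    (h : ∑ i ∈ s, x i ≤ C) : ∏ i ∈ s, (1 + x i) ≤ ENNReal.ofReal (Real.exp C.toReal) := by
  have hx : ∀ i ∈ s, x i ≠ ⊤ := fun i hi =>
    ne_top_of_le_ne_top hC ((Finset.single_le_sum (fun _ _ => zero_le) hi).trans h)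
  calc ∏ i ∈ s, (1 + x i) ≤ ∏ i ∈ s, ENNReal.ofReal (Real.exp (x i).toReal) := by
        refine Finset.prod_le_prod' fun i hi => ?_
        rw [← ENNReal.ofReal_toReal (ENNReal.add_ne_top.2 ⟨ENNReal.one_ne_top, hx i hi⟩)]
        refine ENNReal.ofReal_le_ofReal ?_
        rw [ENNReal.toReal_add ENNReal.one_ne_top (hx i hi), ENNReal.toReal_one, add_comm]
        exact Real.add_one_le_exp _
    _ = ENNReal.ofReal (Real.exp (∑ i ∈ s, x i).toReal) := by
        rw [← ENNReal.ofReal_prod_of_nonneg fun _ _ => (Real.exp_pos _).le, ← Real.exp_sum,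
          ENNReal.toReal_sum hx]
    _ ≤ _ := ENNReal.ofReal_le_ofReal (Real.exp_le_exp.2 (ENNReal.toReal_mono hC h))

end GeneratingFunction

/-- Supplies the cutting times of the Hammersley–Welsh argument; applied to the negated height it
gives the last maximum. -/
theorem exists_last_min (f : ℕ → ℤ) (n : ℕ) :
    ∃ t ≤ n, (∀ k ≤ n, f t ≤ f k) ∧ ∀ k, t < k → k ≤ n → f t < f k := by
  induction n with
  | zero => exact ⟨0, le_rfl, fun k hk => by rw [Nat.le_zero.1 hk], fun k _ _ => by omega⟩
  | succ n ih =>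
    obtain ⟨t, ht, h1, h2⟩ := ih
    by_cases h : f (n + 1) ≤ f t
    · refine ⟨n + 1, le_rfl, fun k hk => ?_, fun k _ _ => by omega⟩
      rcases Nat.le_or_eq_of_le_succ hk with h' | h'
      · exact h.trans (h1 k h')
      · rw [h']
    · refine ⟨t, by omega, fun k hk => ?_, fun k hk hk' => ?_⟩
      · rcases Nat.le_or_eq_of_le_succ hk with h' | h'
        · exact h1 k h'
        · rw [h']; simp only [Nat.succ_eq_add_one]; omega
      · rcases Nat.le_or_eq_of_le_succ hk' with h' | h'
        · exact h2 k hk h'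
        · rw [h']; simp only [Nat.succ_eq_add_one]; omega

/-! ### Hammersley–Welsh and renewal decompositions -/

section Sets

variable (d : ℕ)

/-- The self-avoiding walks that start at the origin. -/
def sawSet : Set (FinWalk d) := {γ | γ.path 0 = 0 ∧ Set.InjOn γ.path (Set.Iic γ.length)}

variable [NeZero d]

/-- The self-avoiding walks in the closed upper half-space. -/
def weakHalfSpaceSet : Set (FinWalk d) := {γ ∈ sawSet d | ∀ j ≤ γ.length, 0 ≤ yCoord (γ.path j)}

/-- The self-avoiding walks that are in the open upper half-space after their start. -/
def halfSpaceSet : Set (FinWalk d) :=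
  {γ ∈ sawSet d | ∀ j, 1 ≤ j → j ≤ γ.length → 0 < yCoord (γ.path j)}

/-- The half-space walks of height at most `a`. -/
def halfSpaceLE (a : ℕ) : Set (FinWalk d) :=
  {γ ∈ halfSpaceSet d | ∀ j ≤ γ.length, yCoord (γ.path j) ≤ a}

/-- The bridges that start at the origin. -/
def bridgeSet : Set (FinWalk d) := {γ | IsBridgeOn γ.path 0 γ.length ∧ γ.path 0 = 0}

/-- The irreducible bridges that start at the origin. -/
def irreducibleSet : Set (FinWalk d) := {γ | γ.IsIrreducibleBridge ∧ γ.path 0 = 0}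

variable {d}

theorem take_mem_sawSet {d : ℕ} {γ : FinWalk d} (h : γ ∈ sawSet d) (n : ℕ) :
    γ.take n ∈ sawSet d := by
  refine ⟨by simp [FinWalk.take, h.1], fun i hi j hj hij => ?_⟩
  simp only [FinWalk.take, Set.mem_Iic] at hi hj hij
  rw [min_eq_left (by omega), min_eq_left (by omega)] at hij
  exact h.2 (Set.mem_Iic.2 (by omega)) (Set.mem_Iic.2 (by omega)) hij

theorem drop_mem_sawSet {d : ℕ} {γ : FinWalk d} (h : γ ∈ sawSet d) {n : ℕ} (hn : n ≤ γ.length) :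
    γ.drop n ∈ sawSet d := by
  refine ⟨by simp [FinWalk.drop], fun i hi j hj hij => ?_⟩
  simp only [FinWalk.drop, Set.mem_Iic, sub_left_inj] at hi hj hij
  have := h.2 (Set.mem_Iic.2 (by omega)) (Set.mem_Iic.2 (by omega)) hij
  omega

theorem rev_mem_sawSet {d : ℕ} {γ : FinWalk d} (h : γ ∈ sawSet d) : γ.rev ∈ sawSet d := by
  refine ⟨by simp [FinWalk.rev], fun i hi j hj hij => ?_⟩
  simp only [FinWalk.rev, Set.mem_Iic, sub_left_inj] at hi hj hij
  have := h.2 (Set.mem_Iic.2 (by omega)) (Set.mem_Iic.2 (by omega)) hij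
  omega

theorem refl_mem_sawSet {d : ℕ} {γ : FinWalk d} (c : Fin d) (h : γ ∈ sawSet d) :
    γ.refl c ∈ sawSet d :=
  ⟨by simp [FinWalk.refl, h.1], fun _ hi _ hj hij => h.2 hi hj (reflect_injective c hij)⟩

theorem mem_sawSet_of_mem_bridgeSet {γ : FinWalk d} (h : γ ∈ bridgeSet d) : γ ∈ sawSet d :=
  ⟨h.2, h.1.2.2.1.mono fun _ hi => Set.mem_Icc.2 ⟨zero_le, hi⟩⟩

theorem irreducibleSet_subset : irreducibleSet d ⊆ bridgeSet d := fun _ h => ⟨h.1.2.1, h.2⟩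

variable (d)

/-- Cut at the last visit to the lowest level: the reversed first piece stays weakly above its
start, and the second piece strictly above. -/
theorem genFun_sawSet_le (z : ℝ≥0∞) :
    genFun z (sawSet d) ≤ genFun z (weakHalfSpaceSet d) * genFun z (halfSpaceSet d) := by
  refine genFun_le_mul z (fun p q => p.rev.append q) fun γ hγ => ?_
  obtain ⟨t, ht, h1, h2⟩ := exists_last_min (fun k => yCoord (γ.path k)) γ.length
  have htl : (γ.take t).length = t := min_eq_left ht
  refine ⟨(γ.take t).rev, ⟨rev_mem_sawSet (take_mem_sawSet hγ t), fun j hj => ?_⟩, γ.drop t,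
    ⟨drop_mem_sawSet hγ ht, fun j hj hj' => ?_⟩, ?_, ?_⟩
  · simp only [FinWalk.rev, htl] at hj ⊢
    have := h1 (t - j) (by omega)
    simpa [FinWalk.take, yCoord_sub] using this
  · simp only [FinWalk.drop] at hj' ⊢
    have := h2 (t + j) (by omega) (by omega)
    simpa [yCoord_sub] using this
  · rw [FinWalk.rev_rev _ (take_mem_sawSet hγ t).1, FinWalk.append_take_drop _ ht]
  · change γ.length = (γ.take t).length + (γ.length - t)
    omega

theorem genFun_halfSpaceLE_zero (z : ℝ≥0∞) : genFun z (halfSpaceLE d 0) ≤ 1 := by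
  have h : ∀ γ ∈ halfSpaceLE d 0, γ.length = 0 := fun γ hγ => by
    by_contra h0
    have h1 := hγ.1.2 γ.length (by omega) le_rfl
    have h2 := hγ.2 γ.length le_rfl
    push_cast at h2
    omega
  let o : FinWalk d := ⟨0, fun _ => 0, fun _ hi => by omega, fun _ _ => rfl⟩
  have : halfSpaceLE d 0 ⊆ {o} := fun γ hγ => by
    refine FinWalk.ext_of_le (h γ hγ) fun k hk => ?_
    rw [h γ hγ, Nat.le_zero] at hk
    rw [hk]
    exact hγ.1.1.1
  simpa [genFun_singleton, o] using genFun_mono z this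

/-- If the walk reaches height a + 1, cut at the last such time. The first piece is a bridge of that
height. The rest, turned upside down, is again a half-space walk; its height is at most a because
the original walk has height at least 1 after time 0. -/
theorem genFun_halfSpaceLE_succ (z : ℝ≥0∞) (a : ℕ) :
    genFun z (halfSpaceLE d (a + 1)) ≤
      (1 + genFun z {γ ∈ bridgeSet d | yCoord (γ.path γ.length) = a + 1}) *
        genFun z (halfSpaceLE d a) := by
  have hsub : halfSpaceLE d (a + 1) ⊆ halfSpaceLE d a ∪
      {γ ∈ halfSpaceLE d (a + 1) | ∃ j ≤ γ.length, yCoord (γ.path j) = a + 1} := fun γ hγ => by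
    by_cases h : ∃ j ≤ γ.length, yCoord (γ.path j) = a + 1
    · exact Or.inr ⟨hγ, h⟩
    · push Not at h
      refine Or.inl ⟨hγ.1, fun j hj => ?_⟩
      have h1 := hγ.2 j hj
      have h2 := h j hj
      push_cast at h1
      omega
  refine (genFun_mono z hsub).trans ((genFun_union_le z _ _).trans ?_)
  rw [add_mul, one_mul]
  gcongr
  refine genFun_le_mul z (fun p q => p.append (q.refl 1)) fun γ hγ => ?_
  obtain ⟨⟨⟨hs, hpos⟩, hle⟩, j, hj, hja⟩ := hγ
  obtain ⟨t, ht, h1, h2⟩ := exists_last_min (fun k => -yCoord (γ.path k)) γ.length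
  have hy0 : yCoord (γ.path 0) = 0 := by rw [hs.1]; rfl
  have hta : yCoord (γ.path t) = a + 1 := by
    have e1 := h1 j hj
    have e2 := hle t ht
    push_cast at e2
    omega
  have ht0 : 1 ≤ t := by
    by_contra h
    rw [show t = 0 by omega] at hta
    omega
  have htl : (γ.take t).length = t := min_eq_left ht
  refine ⟨γ.take t, ⟨⟨?_, (take_mem_sawSet hs t).1⟩, ?_⟩, (γ.drop t).refl 1,
    ⟨⟨refl_mem_sawSet 1 (drop_mem_sawSet hs ht), fun k hk hk' => ?_⟩, fun k hk => ?_⟩, ?_, ?_⟩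
  · rw [htl, FinWalk.isBridgeOn_take _ le_rfl]
    refine ⟨zero_le, fun i _ hi => γ.adj i (by omega),
      hs.2.mono fun i hi => Set.mem_Iic.2 (hi.2.trans ht), fun i hi => ?_, fun i hi => ?_⟩
    · rw [hy0]
      exact hpos i hi.1 (hi.2.trans ht)
    · exact neg_le_neg_iff.1 (h1 i (hi.2.trans ht))
  · rw [htl]
    simpa [FinWalk.take] using hta
  · simp only [FinWalk.refl, FinWalk.drop, yCoord_reflect, yCoord_sub] at hk' ⊢
    have := h2 (t + k) (by omega) (by omega)
    omega
  · simp only [FinWalk.refl, FinWalk.drop, yCoord_reflect, yCoord_sub] at hk ⊢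
    have := hpos (t + k) (by omega) (by omega)
    omega
  · rw [FinWalk.refl_refl, FinWalk.append_take_drop _ ht]
  · change γ.length = (γ.take t).length + (γ.length - t)
    omega

/-- The Hammersley–Welsh bound. -/
theorem genFun_halfSpaceSet_le (z : ℝ≥0∞) (h : genFun z (bridgeSet d) ≠ ⊤) :
    genFun z (halfSpaceSet d) ≤ ENNReal.ofReal (Real.exp (genFun z (bridgeSet d)).toReal) := by
  refine genFun_le_of_exhaustion z (T := halfSpaceLE d) (fun a b hab γ hγ => ⟨hγ.1, fun j hj =>
    (hγ.2 j hj).trans (by exact_mod_cast hab)⟩) (fun γ hγ => ⟨γ.length, hγ, fun j hj => ?_⟩)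
    fun a => ?_
  · have := γ.abs_path_sub_le (zero_le : 0 ≤ j) hj 1
    rw [hγ.1.1] at this
    have h' := (le_abs_self _).trans this
    simp only [Pi.zero_apply, sub_zero] at h'
    change γ.path j 1 ≤ _
    omega
  -- Iterating over heights bounds the half-space walks by the product of 1 + (bridges of height i +
  -- 1), and 1 + x ≤ exp x turns the product into the exponential of a sum over disjoint sets of
  -- bridges.
  · have hprod : genFun z (halfSpaceLE d a) ≤ ∏ i ∈ Finset.range a,
        (1 + genFun z {γ ∈ bridgeSet d | yCoord (γ.path γ.length) = i + 1}) := by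
      induction a with
      | zero => simpa using genFun_halfSpaceLE_zero d z
      | succ a ih =>
        rw [Finset.prod_range_succ, mul_comm]
        exact (genFun_halfSpaceLE_succ d z a).trans (by gcongr)
    refine hprod.trans (prod_one_add_le_exp _ _ h ?_)
    refine sum_genFun_le z _ (fun _ _ γ hγ => hγ.1) fun i _ j _ hij => ?_
    refine Set.disjoint_left.2 fun γ h1 h2 => hij ?_
    have := h1.2.symm.trans h2.2
    omega

variable {d}

theorem append_mem_bridgeSet {p q : FinWalk d} (hp : p ∈ bridgeSet d) (hq : q ∈ bridgeSet d) :
    p.append q ∈ bridgeSet d := by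
  refine ⟨IsBridgeOn.trans (b := p.length) ?_ ?_, ?_⟩
  · rw [FinWalk.isBridgeOn_append_left _ _ le_rfl]; exact hp.1
  · exact (FinWalk.isBridgeOn_append_right p q).2 hq.1
  · rw [FinWalk.append_path_of_le _ _ zero_le, hp.2]

variable (d)

/-- A nontrivial bridge splits at its first renewal point into an irreducible bridge and a bridge.
The truncation keeps the sum finite, so that the inequality can later be solved for it. -/
theorem genFun_bridge_trunc_le (z : ℝ≥0∞) (N : ℕ) :
    genFun z {γ ∈ bridgeSet d | γ.length ≤ N} ≤
      1 + genFun z (irreducibleSet d) * genFun z {γ ∈ bridgeSet d | γ.length ≤ N} := by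
  let o : FinWalk d := ⟨0, fun _ => 0, fun _ hi => by omega, fun _ _ => rfl⟩
  have hsub : {γ ∈ bridgeSet d | γ.length ≤ N} ⊆
      {o} ∪ {γ ∈ bridgeSet d | 1 ≤ γ.length ∧ γ.length ≤ N} := fun γ hγ => by
    rcases Nat.eq_zero_or_pos γ.length with h | h
    · refine Or.inl (FinWalk.ext_of_le h fun k hk => ?_)
      rw [h, Nat.le_zero] at hk
      rw [hk]
      exact hγ.1.2
    · exact Or.inr ⟨hγ.1, h, hγ.2⟩
  refine (genFun_mono z hsub).trans ((genFun_union_le z _ _).trans ?_)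
  refine add_le_add (by simp [genFun_singleton, o]) ?_
  refine genFun_le_mul z FinWalk.append fun γ hγ => ?_
  obtain ⟨⟨hb, h0⟩, h1, hN⟩ := hγ
  classical
  have hex : ∃ k, 1 ≤ k ∧ k ≤ γ.length ∧ IsBridgeOn γ.path 0 k ∧ IsBridgeOn γ.path k γ.length :=
    ⟨γ.length, h1, le_rfl, hb, isBridgeOn_refl _ _⟩
  obtain ⟨k, hk, hmin⟩ : ∃ k, (1 ≤ k ∧ k ≤ γ.length ∧ IsBridgeOn γ.path 0 k ∧
      IsBridgeOn γ.path k γ.length) ∧ ∀ j < k, ¬ (1 ≤ j ∧ j ≤ γ.length ∧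
      IsBridgeOn γ.path 0 j ∧ IsBridgeOn γ.path j γ.length) :=
    ⟨Nat.find hex, Nat.find_spec hex, fun j hj => Nat.find_min hex hj⟩
  obtain ⟨hk1, hkl, hb1, hb2⟩ := hk
  have htl : (γ.take k).length = k := min_eq_left hkl
  have hdl : (γ.drop k).length = γ.length - k := rfl
  refine ⟨γ.take k, ⟨⟨by omega, ?_, fun j hj hj' hjb => ?_⟩, ?_⟩, γ.drop k, ⟨⟨?_, ?_⟩, ?_⟩,
    FinWalk.append_take_drop _ hkl, by omega⟩
  · rw [htl]; exact (FinWalk.isBridgeOn_take _ le_rfl).2 hb1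
  · rw [htl] at hj' hjb
    rw [FinWalk.isBridgeOn_take _ (by omega), FinWalk.isBridgeOn_take _ le_rfl] at hjb
    exact hmin j (by omega) ⟨hj, by omega, hjb.1, hjb.2.trans hb2⟩
  · simpa [FinWalk.take] using h0
  · rw [FinWalk.isBridgeOn_drop, hdl, Nat.add_sub_cancel' hkl]; exact hb2
  · simp [FinWalk.drop]
  · exact (Nat.sub_le _ _).trans hN

/-- The converse renewal inequality: joining an irreducible bridge to a bridge gives a nontrivial
bridge, and the factorization is unique. -/
theorem one_add_mul_genFun_bridge_le (z : ℝ≥0∞) :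
    1 + genFun z (irreducibleSet d) * genFun z (bridgeSet d) ≤ genFun z (bridgeSet d) := by
  let o : FinWalk d := ⟨0, fun _ => 0, fun _ hi => by omega, fun _ _ => rfl⟩
  have ho : o ∈ bridgeSet d := ⟨isBridgeOn_refl _ _, rfl⟩
  have h1 : (1 : ℝ≥0∞) = genFun z {o} := by simp [genFun_singleton, o]
  have h2 : genFun z (irreducibleSet d) * genFun z (bridgeSet d) ≤
      genFun z {γ ∈ bridgeSet d | 1 ≤ γ.length} := by
    refine mul_genFun_le z FinWalk.append (fun p hp q hq => ⟨⟨append_mem_bridgeSet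
      (irreducibleSet_subset hp) hq, ?_⟩, rfl⟩) ?_
    · have := hp.1.1
      change 1 ≤ p.length + q.length
      omega
    -- If two factorizations had first factors of different lengths, the end of the shorter one
    -- would be a renewal point inside the longer one.
    · have key : ∀ p ∈ irreducibleSet d, ∀ q ∈ bridgeSet d, ∀ p' ∈ irreducibleSet d,
          ∀ q' ∈ bridgeSet d, p.append q = p'.append q' → ¬ p.length < p'.length := by
        intro p hp q hq p' hp' q' hq' h hlt
        refine hp'.1.2.2 p.length hp.1.1 hlt ⟨?_, ?_⟩
        · rw [← FinWalk.isBridgeOn_append_left p' q' hlt.le, ← h,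
            FinWalk.isBridgeOn_append_left _ _ le_rfl]
          exact hp.1.2.1
        · have hlen : p.length + q.length = p'.length + q'.length := congrArg FinWalk.length h
          have hb := (FinWalk.isBridgeOn_append_right p q).2 hq.1
          have hb' := (FinWalk.isBridgeOn_append_left p' q' le_rfl).2 hp'.1.2.1
          rw [← FinWalk.isBridgeOn_append_left p' q' le_rfl, ← h]
          rw [← h] at hb'
          refine hb.restrict_right hlt.le (by omega) fun j hj => hb'.2.2.2.2 j ⟨zero_le, hj.2⟩
      intro p hp q hq p' hp' q' hq' h
      have hlen : p.length = p'.length :=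
        le_antisymm (not_lt.1 (key p' hp' q' hq' p hp q hq h.symm))
          (not_lt.1 (key p hp q hq p' hp' q' hq' h))
      refine ⟨?_, ?_⟩
      · rw [← p.take_append q, h, hlen, p'.take_append]
      · rw [← p.drop_append q hq.2, h, hlen, p'.drop_append q' hq'.2]
  have h3 := sum_genFun_le z (Finset.univ : Finset Bool) (T := bridgeSet d)
    (S := fun b => cond b {o} {γ ∈ bridgeSet d | 1 ≤ γ.length}) ?_ ?_
  · simp only [Fintype.univ_bool, Finset.mem_singleton, Bool.true_eq_false, not_false_eq_true,
      Finset.sum_insert, cond_true, Finset.sum_singleton, cond_false] at h3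
    rw [h1]
    exact (add_le_add le_rfl h2).trans h3
  · rintro (_ | _) -
    · exact fun γ hγ => hγ.1
    · exact Set.singleton_subset_iff.2 ho
  · have hdisj : Disjoint ({o} : Set (FinWalk d)) {γ ∈ bridgeSet d | 1 ≤ γ.length} := by
      rw [Set.disjoint_singleton_left]
      exact fun h => absurd h.2 (by simp [o])
    rintro (_ | _) - (_ | _) - hne
    · exact absurd rfl hne
    · exact hdisj.symm
    · exact hdisj
    · exact absurd rfl hne

end Sets

/-! ### The connective constant and the radius of convergence -/

theorem SAW_eq (d n : ℕ) : SAW d n = {γ ∈ sawSet d | γ.length = n} := by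
  ext γ
  constructor
  · rintro ⟨rfl, h0, h1⟩; exact ⟨⟨h0, h1⟩, rfl⟩
  · rintro ⟨⟨h0, h1⟩, rfl⟩; exact ⟨rfl, h0, h1⟩

theorem finite_SAW (d n : ℕ) : (SAW d n).Finite := by
  let f : FinWalk d → (Fin (n + 1) → Lattice d) := fun γ i => γ.path i
  have hfin : (Set.univ.pi fun _ : Fin (n + 1) =>
      Set.univ.pi fun _ : Fin d => Set.Icc (-(n : ℤ)) n).Finite :=
    Set.Finite.pi fun _ => Set.Finite.pi fun _ => Set.finite_Icc _ _
  refine Set.Finite.of_finite_image (f := f) (hfin.subset ?_) ?_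
  · rintro _ ⟨γ, ⟨hl, h0, -⟩, rfl⟩ i - c -
    have h := γ.abs_path_sub_le (zero_le : 0 ≤ (i : ℕ)) (by omega) c
    rw [h0, Pi.zero_apply, sub_zero] at h
    rw [Set.mem_Icc, ← abs_le]
    exact h.trans (by have := i.2; omega)
  · rintro γ ⟨hl, -⟩ η ⟨hl', -⟩ h
    refine FinWalk.ext_of_le (hl.trans hl'.symm) fun k hk => ?_
    exact congrFun h ⟨k, by omega⟩

theorem ncard_SAW_add_le (d m n : ℕ) :
    (SAW d (m + n)).ncard ≤ (SAW d m).ncard * (SAW d n).ncard := by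
  rw [← Set.ncard_prod]
  refine Set.ncard_le_ncard_of_injOn (fun γ => (γ.take m, γ.drop m)) ?_ ?_
    ((finite_SAW d m).prod (finite_SAW d n))
  · intro γ hγ
    rw [SAW_eq] at hγ
    rw [SAW_eq, SAW_eq]
    obtain ⟨hs, hl⟩ := hγ
    refine ⟨⟨take_mem_sawSet hs m, ?_⟩, drop_mem_sawSet hs (by omega), ?_⟩
    · simp [FinWalk.take, hl]
    · simp [FinWalk.drop, hl]
  · rintro γ ⟨hl, -⟩ η ⟨hl', -⟩ h
    have h1 := congrArg Prod.fst h
    have h2 := congrArg Prod.snd h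
    simp only at h1 h2
    rw [← γ.append_take_drop (n := m) (by omega), h1, h2, η.append_take_drop (by omega)]

/-- The straight walk of `n` unit steps in direction `c`. -/
def straightWalk {d : ℕ} (c : Fin d) (n : ℕ) : FinWalk d where
  length := n
  path k := Pi.single c (min k n : ℕ)
  adj i hi := by
    unfold Adj
    rw [Finset.sum_eq_single c]
    · rw [min_eq_left hi.le, min_eq_left (Nat.succ_le_of_lt hi)]; simp
    · intro b _ hb; simp [hb]
    · simp
  stopped k hk := by rw [min_eq_right hk, min_self]

theorem straightWalk_mem_SAW {d : ℕ} (c : Fin d) (n : ℕ) : straightWalk c n ∈ SAW d n := by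
  refine ⟨rfl, by simp [straightWalk], fun i hi j hj h => ?_⟩
  have := congrFun h c
  simp only [straightWalk, Pi.single_eq_same] at this
  simp only [Set.mem_Iic] at hi hj
  omega

theorem one_le_ncard_SAW (d n : ℕ) [NeZero d] : 1 ≤ (SAW d n).ncard :=
  (Set.ncard_pos (finite_SAW d n)).2 ⟨_, straightWalk_mem_SAW 0 n⟩

theorem subadditive_log_ncard_SAW (d : ℕ) [NeZero d] :
    Subadditive fun n => Real.log (SAW d n).ncard := fun m n => by
  have hm : (0 : ℝ) < (SAW d m).ncard := by exact_mod_cast one_le_ncard_SAW d m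
  have hn : (0 : ℝ) < (SAW d n).ncard := by exact_mod_cast one_le_ncard_SAW d n
  have hmn : (0 : ℝ) < (SAW d (m + n)).ncard := by exact_mod_cast one_le_ncard_SAW d (m + n)
  rw [← Real.log_mul hm.ne' hn.ne']
  exact Real.log_le_log hmn (by exact_mod_cast ncard_SAW_add_le d m n)

theorem bddBelow_log_ncard_SAW (d : ℕ) :
    BddBelow (Set.range fun n : ℕ => Real.log (SAW d n).ncard / n) :=
  ⟨0, by rintro _ ⟨n, rfl⟩; exact div_nonneg (Real.log_natCast_nonneg _) n.cast_nonneg⟩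

theorem tendsto_rpow_ncard_SAW (d : ℕ) [NeZero d] :
    Tendsto (fun n : ℕ => ((SAW d n).ncard : ℝ) ^ (1 / (n : ℝ))) atTop
      (nhds (Real.exp (subadditive_log_ncard_SAW d).lim)) := by
  refine ((Real.continuous_exp.tendsto _).comp
    ((subadditive_log_ncard_SAW d).tendsto_lim (bddBelow_log_ncard_SAW d))).congr fun n => ?_
  have hn : (0 : ℝ) < (SAW d n).ncard := by exact_mod_cast one_le_ncard_SAW d n
  rw [Function.comp_apply, Real.rpow_def_of_pos hn, mul_one_div]

theorem connectiveConstant_eq (d : ℕ) [NeZero d] :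
    connectiveConstant d = Real.exp (subadditive_log_ncard_SAW d).lim :=
  (tendsto_rpow_ncard_SAW d).limUnder_eq

theorem connectiveConstant_pos (d : ℕ) [NeZero d] : 0 < connectiveConstant d := by
  rw [connectiveConstant_eq]; exact Real.exp_pos _

/-- In Fekete's lemma the limit is also the infimum, so the bound holds for every n. This makes the
generating function of all walks diverge at the critical point. -/
theorem connectiveConstant_pow_le (d n : ℕ) [NeZero d] :
    connectiveConstant d ^ n ≤ (SAW d n).ncard := by
  have hn : (0 : ℝ) < (SAW d n).ncard := by exact_mod_cast one_le_ncard_SAW d n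
  rcases eq_or_ne n 0 with rfl | h
  · rw [pow_zero]; exact_mod_cast one_le_ncard_SAW d 0
  · have h1 := (subadditive_log_ncard_SAW d).lim_le_div (bddBelow_log_ncard_SAW d) h
    have hn' : (0 : ℝ) < n := by exact_mod_cast Nat.pos_of_ne_zero h
    rw [le_div_iff₀ hn', mul_comm] at h1
    rw [connectiveConstant_eq, ← Real.exp_nat_mul, ← Real.le_log_iff_exp_le hn]
    exact h1

theorem genFun_sawSet_eq_tsum (d : ℕ) (z : ℝ≥0∞) :
    genFun z (sawSet d) = ∑' n, ((SAW d n).ncard : ℝ≥0∞) * z ^ n := by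
  rw [genFun, ← (Equiv.sigmaFiberEquiv fun γ : sawSet d => γ.1.length).tsum_eq, ENNReal.tsum_sigma']
  refine tsum_congr fun n => ?_
  have hc : ∀ γ : {γ : sawSet d // γ.1.length = n},
      z ^ ((Equiv.sigmaFiberEquiv fun γ : sawSet d => γ.1.length) ⟨n, γ⟩).1.length = z ^ n :=
    fun γ => congrArg (z ^ ·) γ.2
  simp_rw [hc]
  let e : {γ : sawSet d // γ.1.length = n} ≃ SAW d n :=
    ⟨fun γ => ⟨γ.1.1, by rw [SAW_eq]; exact ⟨γ.1.2, γ.2⟩⟩,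
      fun γ => ⟨⟨γ.1, ((SAW_eq d n).le γ.2).1⟩, ((SAW_eq d n).le γ.2).2⟩, fun _ => rfl, fun _ => rfl⟩
  rw [e.tsum_eq fun _ => z ^ n]
  have := (finite_SAW d n).fintype
  rw [tsum_fintype, Finset.sum_const, nsmul_eq_mul, Finset.card_univ, ← Nat.card_eq_fintype_card,
    Nat.card_coe_set_eq]

/-- The critical point `1 / μ_c`. -/
noncomputable def criticalPoint (d : ℕ) : ℝ≥0∞ := ENNReal.ofReal (connectiveConstant d)⁻¹

theorem criticalPoint_pos (d : ℕ) [NeZero d] : 0 < criticalPoint d :=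
  ENNReal.ofReal_pos.2 (inv_pos.2 (connectiveConstant_pos d))

theorem genFun_sawSet_criticalPoint (d : ℕ) [NeZero d] :
    genFun (criticalPoint d) (sawSet d) = ⊤ := by
  rw [genFun_sawSet_eq_tsum, eq_top_iff,
    ← ENNReal.tsum_const_eq_top_of_ne_zero (α := ℕ) one_ne_zero]
  refine ENNReal.tsum_le_tsum fun n => ?_
  have hμ := connectiveConstant_pos d
  rw [criticalPoint, ← ENNReal.ofReal_pow (inv_pos.2 hμ).le, ← ENNReal.ofReal_natCast,
    ← ENNReal.ofReal_mul (Nat.cast_nonneg _), ENNReal.one_le_ofReal, inv_pow]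
  rw [← div_eq_mul_inv, one_le_div (pow_pos hμ n)]
  exact connectiveConstant_pow_le d n

/-- Root test: for w strictly between z and 1/μ_c, the n-th term is eventually at most (z/w)^n. -/
theorem genFun_sawSet_lt_top (d : ℕ) [NeZero d] {z : ℝ≥0∞} (hz : z < criticalPoint d) :
    genFun z (sawSet d) < ⊤ := by
  have hμ := connectiveConstant_pos d
  lift z to NNReal using hz.ne_top
  have hz' : (z : ℝ) < (connectiveConstant d)⁻¹ := by
    rw [criticalPoint, ENNReal.lt_ofReal_iff_toReal_lt ENNReal.coe_ne_top] at hz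
    simpa using hz
  obtain ⟨w, hzw, hw⟩ := exists_between hz'
  have hw0 : 0 < w := z.2.trans_lt hzw
  have hμw : connectiveConstant d < w⁻¹ := (lt_inv_comm₀ hw0 hμ).1 hw
  have hev : ∀ᶠ n : ℕ in atTop, ((SAW d n).ncard : ℝ) * (z : ℝ) ^ n ≤ ((z : ℝ) / w) ^ n := by
    have h1 := (tendsto_rpow_ncard_SAW d).eventually_lt_const
      (by rwa [← connectiveConstant_eq] : _ < w⁻¹)
    filter_upwards [h1, eventually_ne_atTop 0] with n hn hn0
    have h2 : ((SAW d n).ncard : ℝ) ≤ w⁻¹ ^ n := by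
      have := pow_le_pow_left₀ (by positivity) hn.le n
      rwa [one_div, Real.rpow_inv_natCast_pow (Nat.cast_nonneg _) hn0] at this
    rw [div_eq_inv_mul, mul_pow]
    gcongr
  have hsum : Summable fun n : ℕ => ((SAW d n).ncard : ℝ) * (z : ℝ) ^ n := by
    have hg : Summable fun n : ℕ => ((z : ℝ) / w) ^ n :=
      summable_geometric_of_lt_one (by positivity) ((div_lt_one hw0).2 hzw)
    refine hg.of_norm_bounded_eventually_nat ?_
    filter_upwards [hev] with n hn
    rwa [Real.norm_of_nonneg (by positivity)]
  rw [genFun_sawSet_eq_tsum]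
  have h3 : ∀ n, ((SAW d n).ncard : ℝ≥0∞) * (z : ℝ≥0∞) ^ n =
      ENNReal.ofReal (((SAW d n).ncard : ℝ) * (z : ℝ) ^ n) := fun n => by
    rw [ENNReal.ofReal_mul (Nat.cast_nonneg _), ENNReal.ofReal_natCast,
      ENNReal.ofReal_pow z.coe_nonneg, ENNReal.ofReal_coe_nnreal]
  simp_rw [h3]
  rw [← ENNReal.ofReal_tsum_of_nonneg (fun n => by positivity) hsum]
  exact ENNReal.ofReal_lt_top

/-! ### Kesten's relation -/

section

variable (d : ℕ) [NeZero d]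

/-- If it were finite, Hammersley–Welsh would bound the half-space walks, hence the weak half-space
walks, hence all self-avoiding walks, whose series diverges at 1/μ_c. -/
theorem genFun_bridgeSet_criticalPoint :
    genFun (criticalPoint d) (bridgeSet d) = ⊤ := by
  by_contra h
  set z := criticalPoint d
  have hH : genFun z (halfSpaceSet d) ≠ ⊤ :=
    ne_top_of_le_ne_top ENNReal.ofReal_ne_top (genFun_halfSpaceSet_le d z h)
  have hu : ∀ k, yCoord ((straightWalk (1 : Fin d) 1).path k) = (min k 1 : ℕ) := fun k => by
    simp [yCoord, straightWalk]
  -- Prepending one upward step turns a weak half-space walk into a strict one, at the cost of one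
  -- factor z.
  have hW : z * genFun z (weakHalfSpaceSet d) ≤ genFun z (halfSpaceSet d) := by
    have h1 : z = genFun z {straightWalk (1 : Fin d) 1} := by
      rw [genFun_singleton]; exact (pow_one z).symm
    conv_lhs => enter [1]; rw [h1]
    refine mul_genFun_le z FinWalk.append ?_ ?_
    · rintro p hp q ⟨hq, hq'⟩
      rw [Set.mem_singleton_iff] at hp
      have hp1 : p.length = 1 := by rw [hp]; rfl
      have hpath : ∀ k, (p.append q).path (1 + k) = p.path 1 + q.path k := fun k => by
        have := p.append_path_add q k
        rwa [hp1, hq.1, sub_zero] at this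
      have hp0 : p.path 0 = 0 := by rw [hp]; simp [straightWalk]
      have h0 : (p.append q).path 0 = 0 := by rw [p.append_path_of_le q zero_le, hp0]
      have hpos : ∀ j, 1 ≤ j → j ≤ (p.append q).length → 0 < yCoord ((p.append q).path j) := by
        intro j hj hj'
        change j ≤ p.length + q.length at hj'
        obtain ⟨k, rfl⟩ := Nat.exists_eq_add_of_le hj
        rw [hpath, yCoord_add, hp, hu]
        have := hq' k (by omega)
        simp only [min_self, Nat.cast_one]
        omega
      refine ⟨⟨⟨h0, fun i hi j hj hij => ?_⟩, hpos⟩, rfl⟩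
      have hl : (p.append q).length = 1 + q.length := by rw [← hp1]; rfl
      simp only [Set.mem_Iic] at hi hj
      rcases Nat.eq_zero_or_pos i with rfl | hi0 <;> rcases Nat.eq_zero_or_pos j with rfl | hj0
      · rfl
      · have := hpos j hj0 hj
        rw [← hij, h0] at this
        simp at this
      · have := hpos i hi0 hi
        rw [hij, h0] at this
        simp at this
      · obtain ⟨k, rfl⟩ := Nat.exists_eq_add_of_le hi0
        obtain ⟨l, rfl⟩ := Nat.exists_eq_add_of_le hj0
        simp only [zero_add, Nat.succ_eq_add_one] at hij hi hj ⊢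
        rw [hpath, hpath, add_right_inj] at hij
        rw [hq.2 (Set.mem_Iic.2 (by omega)) (Set.mem_Iic.2 (by omega)) hij]
    · rintro p hp q hq p' hp' q' hq' hpq
      have hpp : p = p' := hp.trans hp'.symm
      subst hpp
      exact ⟨rfl, by rw [← p.drop_append q hq.1.1, hpq, p.drop_append q' hq'.1.1]⟩
  have hW' : genFun z (weakHalfSpaceSet d) ≠ ⊤ := fun hc => by
    rw [hc, ENNReal.mul_top (criticalPoint_pos d).ne', top_le_iff] at hW
    exact hH hW
  have := genFun_sawSet_le d z
  rw [genFun_sawSet_criticalPoint, top_le_iff] at this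
  exact ENNReal.mul_ne_top hW' hH this

/-- Below the critical point the bridge series B is finite, so 1 + I B ≤ B excludes I > 1. -/
theorem genFun_irreducibleSet_le_one {z : ℝ≥0∞} (hz : z < criticalPoint d) :
    genFun z (irreducibleSet d) ≤ 1 := by
  have hB : genFun z (bridgeSet d) ≠ ⊤ :=
    ((genFun_mono z fun γ hγ => mem_sawSet_of_mem_bridgeSet hγ).trans_lt
      (genFun_sawSet_lt_top d hz)).ne
  have h := one_add_mul_genFun_bridge_le d z
  by_contra! h1
  have h2 : genFun z (bridgeSet d) ≤ genFun z (irreducibleSet d) * genFun z (bridgeSet d) :=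
    le_mul_of_one_le_left' h1.le
  have h3 : 1 + genFun z (bridgeSet d) ≤ 0 + genFun z (bridgeSet d) := by
    rw [zero_add]; exact (add_le_add le_rfl h2).trans h
  exact absurd ((ENNReal.add_le_add_iff_right hB).1 h3) (by simp)

/-- Kesten's relation: the weights `μ_c^{-|γ|}` of the irreducible bridges sum to one. -/
theorem genFun_irreducibleSet_criticalPoint :
    genFun (criticalPoint d) (irreducibleSet d) = 1 := by
  set z := criticalPoint d with hz
  apply le_antisymm
  -- Each finite partial sum is continuous in z, so the subcritical bound passes to the left limit.
  · rw [genFun, ENNReal.tsum_eq_iSup_sum]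
    refine iSup_le fun s => ?_
    have hcont : Continuous fun w : ℝ≥0∞ => ∑ γ ∈ s, w ^ γ.1.length :=
      continuous_finsetSum _ fun γ _ => ENNReal.continuous_pow _
    have : (nhdsWithin z (Set.Iio z)).NeBot := nhdsLT_neBot_of_exists_lt ⟨0, criticalPoint_pos d⟩
    refine le_of_tendsto (hcont.continuousWithinAt (s := Set.Iio z) (x := z)) ?_
    filter_upwards [self_mem_nhdsWithin] with w hw
    exact (ENNReal.sum_le_tsum s).trans (genFun_irreducibleSet_le_one d hw)
  · by_contra! h
    set I := genFun z (irreducibleSet d)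
    -- If I < 1, the renewal inequality b ≤ 1 + I b for the finite truncated sum gives b ≤ 1/(1 - I)
    -- uniformly in N, contradicting divergence of the bridge series.
    have hbound : ∀ N, genFun z {γ ∈ bridgeSet d | γ.length ≤ N} ≤ (1 - I)⁻¹ := fun N => by
      have h1 := genFun_bridge_trunc_le d z N
      set b := genFun z {γ ∈ bridgeSet d | γ.length ≤ N}
      have hb : b ≠ ⊤ := by
        have hle : b ≤ ∑ n ∈ Finset.range (N + 1), ((SAW d n).ncard : ℝ≥0∞) * z ^ n := by
          have hs : b ≤ ∑ n ∈ Finset.range (N + 1), genFun z (SAW d n) := by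
            have : {γ ∈ bridgeSet d | γ.length ≤ N} ⊆
                ⋃ n ∈ Finset.range (N + 1), SAW d n := fun γ hγ => by
              refine Set.mem_biUnion (x := γ.length) (by
                have := hγ.2; simp only [Finset.coe_range, Set.mem_Iio]; omega) ?_
              rw [SAW_eq]
              exact ⟨mem_sawSet_of_mem_bridgeSet hγ.1, rfl⟩
            exact (genFun_mono z this).trans
              (ENNReal.tsum_biUnion_le (fun γ : FinWalk d => z ^ γ.length) _ _)
          refine hs.trans (Finset.sum_le_sum fun n _ => ?_)
          have := (finite_SAW d n).fintype
          rw [genFun, tsum_fintype, Finset.sum_congr rfl fun γ _ => by rw [γ.2.1],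
            Finset.sum_const, nsmul_eq_mul, Finset.card_univ, ← Nat.card_eq_fintype_card,
            Nat.card_coe_set_eq]
        refine ne_top_of_le_ne_top (ENNReal.sum_ne_top.2 fun n _ => ?_) hle
        exact ENNReal.mul_ne_top (ENNReal.natCast_ne_top _)
          (ENNReal.pow_ne_top ENNReal.ofReal_ne_top)
      rw [ENNReal.le_inv_iff_mul_le, ENNReal.mul_sub fun _ _ => hb, mul_one, mul_comm]
      exact tsub_le_iff_right.2 h1
    have htop := genFun_bridgeSet_criticalPoint d
    have hle : genFun z (bridgeSet d) ≤ (1 - I)⁻¹ :=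
      genFun_le_of_exhaustion z (T := fun N => {γ ∈ bridgeSet d | γ.length ≤ N})
        (fun a b hab γ hγ => ⟨hγ.1, hγ.2.trans hab⟩) (fun γ hγ => ⟨γ.length, hγ, le_rfl⟩) hbound
    rw [htop, top_le_iff, ENNReal.inv_eq_top, tsub_eq_zero_iff_le] at hle
    exact absurd hle (not_le.2 h)

theorem iSABLaw_apply_eq_tsum (s : Set (ISAB d)) :
    iSABLaw d s = ∑' γ : ISAB d, criticalPoint d ^ γ.length * s.indicator 1 γ := by
  rw [iSABLaw, Measure.sum_apply _ MeasurableSpace.measurableSet_top]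
  refine tsum_congr fun γ => ?_
  rw [Measure.smul_apply, Measure.dirac_apply' _ MeasurableSpace.measurableSet_top, smul_eq_mul,
    criticalPoint, ← ENNReal.ofReal_pow (inv_pos.2 (connectiveConstant_pos d)).le, inv_pow]

instance isProbabilityMeasure_iSABLaw : IsProbabilityMeasure (iSABLaw d) := by
  refine ⟨?_⟩
  rw [iSABLaw_apply_eq_tsum, ← genFun_irreducibleSet_criticalPoint d]
  simp only [Set.indicator_univ, Pi.one_apply, mul_one]
  rfl

theorem iSABLaw_singleton_pos (γ : ISAB d) : 0 < iSABLaw d {γ} := by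
  rw [iSABLaw_apply_eq_tsum]
  refine lt_of_lt_of_le ?_ (ENNReal.le_tsum γ)
  simpa using ENNReal.pow_pos (criticalPoint_pos d) _

end

/-! ### The maximal ergodic theorem -/

section Ergodic

variable {α : Type*}

/-- The maximum of the Birkhoff sums of orders `0, …, n`. -/
noncomputable def maxBirkhoff (T : α → α) (f : α → ℝ) : ℕ → α → ℝ
  | 0 => fun _ => 0
  | n + 1 => fun x => max 0 (f x + maxBirkhoff T f n (T x))

theorem maxBirkhoff_nonneg (T : α → α) (f : α → ℝ) (n : ℕ) (x : α) : 0 ≤ maxBirkhoff T f n x := by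
  cases n with
  | zero => exact le_rfl
  | succ n => exact le_max_left _ _

theorem maxBirkhoff_le_succ (T : α → α) (f : α → ℝ) (n : ℕ) (x : α) :
    maxBirkhoff T f n x ≤ maxBirkhoff T f (n + 1) x := by
  induction n generalizing x with
  | zero => exact le_max_left _ _
  | succ n ih => exact max_le_max le_rfl (add_le_add le_rfl (ih (T x)))

theorem birkhoffSum_le_maxBirkhoff (T : α → α) (f : α → ℝ) (n : ℕ) (x : α) :
    birkhoffSum T f n x ≤ maxBirkhoff T f n x := by
  induction n generalizing x with
  | zero => simp [maxBirkhoff]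
  | succ n ih =>
    rw [birkhoffSum_succ']
    exact (add_le_add le_rfl (ih (T x))).trans (le_max_right _ _)

variable [MeasurableSpace α] {μ : Measure α} {T : α → α}

theorem measurable_maxBirkhoff (hT : Measurable T) {f : α → ℝ} (hf : Measurable f) (n : ℕ) :
    Measurable (maxBirkhoff T f n) := by
  induction n with
  | zero => exact measurable_const
  | succ n ih => exact measurable_const.max (hf.add (ih.comp hT))

theorem integrable_maxBirkhoff [IsFiniteMeasure μ] (hT : MeasurePreserving T μ μ) {f : α → ℝ}
    (hf : Integrable f μ) (n : ℕ) : Integrable (maxBirkhoff T f n) μ := by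
  induction n with
  | zero => exact integrable_const 0
  | succ n ih => exact (integrable_const 0).sup (hf.add (hT.integrable_comp_of_integrable ih))

/-- The maximal ergodic theorem. -/
theorem setIntegral_maxBirkhoff_nonneg [IsFiniteMeasure μ] (hT : MeasurePreserving T μ μ)
    {f : α → ℝ} (hfm : Measurable f) (hf : Integrable f μ) (n : ℕ) :
    0 ≤ ∫ x in {x | 0 < maxBirkhoff T f n x}, f x ∂μ := by
  cases n with
  | zero => simp [maxBirkhoff]
  | succ n =>
    set M := maxBirkhoff T f (n + 1) with hM
    have hMi : Integrable M μ := integrable_maxBirkhoff hT hf (n + 1)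
    have hMT : Integrable (fun x => M (T x)) μ := hT.integrable_comp_of_integrable hMi
    have hS : MeasurableSet {x | 0 < M x} :=
      measurableSet_lt measurable_const (measurable_maxBirkhoff hT.measurable hfm (n + 1))
    rw [← integral_indicator hS]
    have h0 : ∫ x, (M x - M (T x)) ∂μ = 0 := by
      rw [integral_sub hMi hMT, sub_eq_zero]
      have hae : AEStronglyMeasurable M (μ.map T) := by rw [hT.map_eq]; exact hMi.1
      rw [← integral_map hT.aemeasurable hae, hT.map_eq]
    -- Garsia's argument: M - M ∘ T has mean zero and is at most f on {M > 0}. Elsewhere M = 0 and M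
    -- ∘ T ≥ 0, so it is at most 0.
    refine h0.ge.trans (integral_mono (hMi.sub hMT) (hf.indicator hS) fun x => ?_)
    by_cases hx : 0 < M x
    · rw [Set.indicator_of_mem (by exact hx)]
      have h1 : M x = f x + maxBirkhoff T f n (T x) := by
        rcases max_choice 0 (f x + maxBirkhoff T f n (T x)) with h | h
        · exact absurd hx (by rw [hM]; simp only [maxBirkhoff, h, lt_irrefl, not_false_eq_true])
        · exact h
      have h2 := maxBirkhoff_le_succ T f n (T x)
      simp only
      rw [h1]
      linarith
    · rw [Set.indicator_of_notMem (by exact hx)]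
      have h1 := maxBirkhoff_nonneg T f (n + 1) (T x)
      simp only
      linarith [not_lt.1 hx]

/-- The Birkhoff sums of a function of negative mean over an ergodic map are bounded above. -/
theorem ae_bddAbove_birkhoffSum [IsProbabilityMeasure μ] (hT : Ergodic T μ) {f : α → ℝ}
    (hfm : Measurable f) (hf : Integrable f μ) (hneg : ∫ x, f x ∂μ < 0) :
    ∀ᵐ x ∂μ, BddAbove (Set.range fun n => birkhoffSum T f n x) := by
  have hbm : ∀ n, Measurable (birkhoffSum T f n) := fun n => by
    unfold birkhoffSum
    exact Finset.measurable_sum _ fun i _ => hfm.comp (hT.measurable.iterate i)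
  set A : Set α := {x | ∀ K : ℕ, ∃ n, (K : ℝ) < birkhoffSum T f n x} with hA
  have hAm : MeasurableSet A := by
    have : A = ⋂ K : ℕ, ⋃ n, {x | (K : ℝ) < birkhoffSum T f n x} := by ext; simp [hA]
    rw [this]
    exact .iInter fun K => .iUnion fun n => measurableSet_lt measurable_const (hbm n)
  have hAinv : T ⁻¹' A = A := by
    ext x
    constructor
    · intro h K
      obtain ⟨K', hK'⟩ := exists_nat_ge ((K : ℝ) - f x)
      obtain ⟨n, hn⟩ := h K'
      exact ⟨n + 1, by rw [birkhoffSum_succ']; linarith⟩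
    · intro h K
      obtain ⟨K', hK'⟩ := exists_nat_ge (max 0 ((K : ℝ) + f x))
      obtain ⟨n, hn⟩ := h K'
      cases n with
      | zero =>
        rw [birkhoffSum_zero] at hn
        exact absurd hn (not_lt.2 (Nat.cast_nonneg _))
      | succ n =>
        rw [birkhoffSum_succ'] at hn
        exact ⟨n, by linarith [le_max_right 0 ((K : ℝ) + f x)]⟩
  rcases hT.ae_mem_or_ae_notMem hAm hAinv with h | h
  -- If the sums were almost surely unbounded, the sets {M_n > 0} would increase to a set of full
  -- measure, and the maximal inequality would pass to the limit as ∫ f ≥ 0.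
  · exfalso
    have hmono : Monotone fun n => {x | 0 < maxBirkhoff T f n x} :=
      monotone_nat_of_le_succ fun n x (hx : 0 < _) => hx.trans_le (maxBirkhoff_le_succ T f n x)
    have hlim := tendsto_setIntegral_of_monotone (f := f) (μ := μ)
      (fun n => measurableSet_lt measurable_const (measurable_maxBirkhoff hT.measurable hfm n))
      hmono hf.integrableOn
    have hfull : (⋃ n, {x | 0 < maxBirkhoff T f n x} : Set α) =ᵐ[μ] Set.univ := by
      rw [eventuallyEq_univ]
      filter_upwards [h] with x hx
      obtain ⟨n, hn⟩ := hx 0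
      refine Set.mem_iUnion.2 ⟨n, lt_of_lt_of_le ?_ (birkhoffSum_le_maxBirkhoff T f n x)⟩
      exact_mod_cast hn
    rw [setIntegral_congr_set hfull, setIntegral_univ] at hlim
    exact absurd hneg (not_lt.2 (ge_of_tendsto' hlim fun n =>
      setIntegral_maxBirkhoff_nonneg hT.toMeasurePreserving hfm hf n))
  · filter_upwards [h] with x hx
    simp only [hA, Set.mem_ofPred_eq, not_forall, not_exists, not_lt] at hx
    obtain ⟨K, hK⟩ := hx
    exact ⟨K, by rintro _ ⟨n, rfl⟩; exact hK n⟩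

end Ergodic

/-! ### Bernoulli shifts -/

section Shift

variable {X : Type*} [MeasurableSpace X] (ν : Measure X) [IsProbabilityMeasure ν]

theorem measure_inter_cylinderEvents {ι : Type*} {S S' : Set ι} (h : Disjoint S S')
    {A B : Set (ι → X)} (hA : MeasurableSet[cylinderEvents (X := fun _ => X) S] A)
    (hB : MeasurableSet[cylinderEvents (X := fun _ => X) S'] B) :
    Measure.infinitePi (fun _ : ι => ν) (A ∩ B) =
      Measure.infinitePi (fun _ : ι => ν) A * Measure.infinitePi (fun _ : ι => ν) B := by
  have hi : ProbabilityTheory.iIndepFun (fun (i : ι) (ω : ι → X) => ω i)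
      (Measure.infinitePi fun _ : ι => ν) :=
    ProbabilityTheory.iIndepFun_infinitePi (X := fun _ x => x) fun _ => measurable_id
  exact (ProbabilityTheory.Indep_iff _ _ _).1 (ProbabilityTheory.indep_iSup_of_disjoint
    (fun i => (measurable_pi_apply i).comap_le) hi h) A B hA hB

/-- Used for the shift, for the restriction of two-sided sequences to ℕ, and for the two half-lines
away from the origin. -/
theorem measurePreserving_reindex {ι κ : Type*} {f : κ → ι} (hf : Function.Injective f) :
    MeasurePreserving (fun (ω : ι → X) (k : κ) => ω (f k)) (Measure.infinitePi fun _ : ι => ν)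
      (Measure.infinitePi fun _ : κ => ν) :=
  ⟨measurable_pi_lambda _ fun _ => measurable_pi_apply _,
    Measure.map_infinitePi_infinitePi_of_inj (P := fun _ : ι => ν) hf⟩

/-- The shift of two-sided sequences. -/
def shift {X : Type*} (ω : ℤ → X) (i : ℤ) : X := ω (i + 1)

theorem shift_iterate {X : Type*} (n : ℕ) (ω : ℤ → X) : shift^[n] ω = fun i => ω (i + n) := by
  induction n generalizing ω with
  | zero => simp
  | succ n ih =>
    rw [Function.iterate_succ_apply, ih]
    funext i
    simp only [shift]
    congr 1
    push_cast
    ring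

theorem measurePreserving_shift :
    MeasurePreserving (shift (X := X)) (Measure.infinitePi fun _ : ℤ => ν)
      (Measure.infinitePi fun _ : ℤ => ν) :=
  measurePreserving_reindex ν (add_left_injective (1 : ℤ))

theorem measurableSet_cylinderEvents_cylinder {ι : Type*} (I : Finset ι) {S : Set (I → X)}
    (hS : MeasurableSet S) :
    MeasurableSet[cylinderEvents (X := fun _ => X) (I : Set ι)]
      (cylinder (α := fun _ => X) I S) :=
  measurable_restrict_cylinderEvents (X := fun _ => X) (I : Set ι) hS

/-- Bernoulli shifts are ergodic. -/
theorem ergodic_shift : Ergodic (shift (X := X)) (Measure.infinitePi fun _ : ℤ => ν) := by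
  refine ⟨measurePreserving_shift ν, ⟨fun A hA hinv => ?_⟩⟩
  set μ := Measure.infinitePi fun _ : ℤ => ν with hμ
  have hinv' : ∀ n : ℕ, shift^[n] ⁻¹' A = A := fun n => by
    induction n with
    | zero => rfl
    | succ n ih => rw [Function.iterate_succ, Set.preimage_comp, ih, hinv]
  have halg : IsSetAlgebra (measurableCylinders fun _ : ℤ => X) :=
    ⟨empty_mem_measurableCylinders _, fun _ hs => compl_mem_measurableCylinders hs,
      fun _ _ hs ht => union_mem_measurableCylinders hs ht⟩
  have hdense : μ.MeasureDense (measurableCylinders fun _ : ℤ => X) :=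
    .of_generateFrom_isSetAlgebra_finite μ halg generateFrom_measurableCylinders.symm
  -- Approximate A by a cylinder C and shift C until its coordinates are disjoint from the old ones.
  -- Invariance makes both cylinders ε-close to A, and independence then gives μ(A) ≈ μ(A)². The
  -- error is 2ε from the intersection and 2ε from the product.
  have key : ∀ ε : ℝ, 0 < ε → |μ.real A - μ.real A * μ.real A| ≤ 4 * ε := by
    intro ε hε
    obtain ⟨C, hC, hAC⟩ := hdense.approx A hA (measure_ne_top _ _) ε hε
    obtain ⟨I, S, hS, rfl⟩ := (mem_measurableCylinders _).1 hC
    set C := cylinder (α := fun _ : ℤ => X) I S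
    have hCm : MeasurableSet C := .of_mem_measurableCylinders hC
    obtain ⟨n, hn⟩ : ∃ n : ℕ, ∀ i ∈ I, ∀ j ∈ I, i + n ≠ j := by
      obtain ⟨m, hm⟩ := (I : Set ℤ).toFinite.bddAbove
      obtain ⟨l, hl⟩ := (I : Set ℤ).toFinite.bddBelow
      refine ⟨(m - l + 1).toNat, fun i hi j hj => ?_⟩
      have h1 := hm (Finset.mem_coe.2 hj)
      have h2 := hl (Finset.mem_coe.2 hi)
      omega
    have hT := (measurePreserving_shift ν).iterate n
    set C' := shift^[n] ⁻¹' C with hC'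
    have hCC : μ (C ∩ C') = μ C * μ C' := by
      refine measure_inter_cylinderEvents ν (S := (I : Set ℤ))
        (S' := (fun i => i + (n : ℤ)) '' (I : Set ℤ)) ?_
        (measurableSet_cylinderEvents_cylinder I hS) ?_
      · rw [Set.disjoint_left]
        rintro _ hj ⟨i, hi, rfl⟩
        exact hn i hi _ hj rfl
      · have : Measurable[cylinderEvents (X := fun _ => X)
            ((fun i => i + (n : ℤ)) '' (I : Set ℤ))]
            (fun (ω : ℤ → X) (i : I) => ω (i + n)) := by
          exact @measurable_pi_lambda _ _ _ (_) _ _ fun i =>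
            measurable_cylinderEvent_apply (X := fun _ => X)
            (Set.mem_image_of_mem _ i.2)
        have h2 := this hS
        convert! h2 using 1
        rw [hC']
        ext ω
        simp [C, shift_iterate, mem_cylinder, Finset.restrict_def]
    have hC'eq : μ C' = μ C := hT.measure_preimage hCm.nullMeasurableSet
    have e1 : μ.real (symmDiff A C) < ε := by
      rw [measureReal_def]
      exact (ENNReal.toReal_lt_of_lt_ofReal hAC)
    have e2 : μ.real (symmDiff A C') < ε := by
      have : symmDiff A C' = shift^[n] ⁻¹' (symmDiff A C) := by
        rw [Set.preimage_symmDiff, hinv']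
      rw [measureReal_def, this, hT.measure_preimage (hA.symmDiff hCm).nullMeasurableSet]
      exact e1
    have e3 : |μ.real A - μ.real C| ≤ ε :=
      (abs_measureReal_sub_le_measureReal_symmDiff hA.nullMeasurableSet
        hCm.nullMeasurableSet).trans e1.le
    have e4 : |μ.real A - μ.real (C ∩ C')| ≤ 2 * ε := by
      have hC'm : MeasurableSet C' := hT.measurable hCm
      refine (abs_measureReal_sub_le_measureReal_symmDiff hA.nullMeasurableSet
        (hCm.inter hC'm).nullMeasurableSet).trans ?_
      have hsub : symmDiff A (C ∩ C') ⊆ symmDiff A C ∪ symmDiff A C' := by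
        intro ω
        simp only [Set.mem_symmDiff, Set.mem_inter_iff, Set.mem_union]
        tauto
      have := (measureReal_mono (μ := μ) hsub).trans (measureReal_union_le _ _)
      linarith
    have e5 : μ.real (C ∩ C') = μ.real C * μ.real C := by
      rw [measureReal_def, hCC, ENNReal.toReal_mul, hC'eq]; rfl
    rw [e5] at e4
    have hA1 : μ.real A ≤ 1 := measureReal_le_one
    have hC1 : μ.real C ≤ 1 := measureReal_le_one
    have hA0 : 0 ≤ μ.real A := measureReal_nonneg
    have hC0 : 0 ≤ μ.real C := measureReal_nonneg
    rw [abs_le] at e3 e4 ⊢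
    constructor <;> nlinarith
  have h0 : μ.real A - μ.real A * μ.real A = 0 := by
    by_contra hne
    have := key (|μ.real A - μ.real A * μ.real A| / 8) (by positivity)
    have hpos := abs_pos.2 hne
    linarith
  rw [eventuallyConst_set']
  have h1 : μ.real A * (1 - μ.real A) = 0 := by linarith
  rcases mul_eq_zero.1 h1 with h | h
  · left
    rw [ae_eq_empty]
    exact (measureReal_eq_zero_iff).1 h
  · right
    rw [eventuallyEq_univ, mem_ae_iff, prob_compl_eq_zero_iff hA]
    rw [measureReal_def, sub_eq_zero] at h
    exact (ENNReal.toReal_eq_one_iff _).1 h.symm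

end Shift

/-! ### Displacements and excursions of irreducible bridges -/

section Block

variable {d : ℕ} [NeZero d]

/-- The linear form `y + σ x`; for `σ = ± 1` these are the forms that define diamond points. -/
def tilt (σ : ℤ) (u : Lattice d) : ℤ := yCoord u + σ * xCoord u

theorem tilt_add (σ : ℤ) (u v : Lattice d) : tilt σ (u + v) = tilt σ u + tilt σ v := by
  simp only [tilt, yCoord, xCoord, Pi.add_apply]; ring

@[simp] theorem tilt_zero (σ : ℤ) : tilt σ (0 : Lattice d) = 0 := by
  simp [tilt, yCoord, xCoord]

theorem tilt_sum (σ : ℤ) {ι : Type*} (s : Finset ι) (u : ι → Lattice d) :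
    tilt σ (∑ i ∈ s, u i) = ∑ i ∈ s, tilt σ (u i) :=
  map_sum (⟨⟨tilt σ, tilt_zero σ⟩, tilt_add σ⟩ : Lattice d →+ ℤ) u s

/-- The displacement of an irreducible bridge. -/
def ISAB.disp (γ : ISAB d) : Lattice d := γ.path γ.length

theorem ISAB.isBridgeOn (γ : ISAB d) : IsBridgeOn γ.path 0 γ.length := γ.2.1.2.1

theorem ISAB.one_le_yCoord_disp (γ : ISAB d) : 1 ≤ yCoord γ.disp := by
  have := γ.isBridgeOn.2.2.2.1 γ.length ⟨γ.one_le_length, le_rfl⟩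
  rwa [γ.path_zero] at this

theorem ISAB.abs_tilt_sub_le (γ : ISAB d) {σ : ℤ} (hσ : |σ| = 1) {i j : ℕ} (hij : i ≤ j)
    (hj : j ≤ γ.length) : |tilt σ (γ.path j) - tilt σ (γ.path i)| ≤ 2 * γ.length := by
  have h0 := γ.1.abs_path_sub_le hij hj 0
  have h1 := γ.1.abs_path_sub_le hij hj 1
  have e : tilt σ (γ.path j) - tilt σ (γ.path i) =
      (γ.path j 1 - γ.path i 1) + σ * (γ.path j 0 - γ.path i 0) := by
    simp only [tilt, yCoord, xCoord]; ring
  rw [e]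
  refine (abs_add_le _ _).trans ?_
  rw [abs_mul, hσ, one_mul]
  change |γ.path j 0 - γ.path i 0| ≤ _ at h0
  change |γ.path j 1 - γ.path i 1| ≤ _ at h1
  omega

theorem ISAB.abs_tilt_disp_le (γ : ISAB d) {σ : ℤ} (hσ : |σ| = 1) :
    |tilt σ γ.disp| ≤ 2 * γ.length := by
  have := γ.abs_tilt_sub_le hσ zero_le le_rfl
  rwa [γ.path_zero, tilt_zero, sub_zero] at this

variable (d) in
/-- The irreducible bridge that consists of one step up. -/
def upBlock : ISAB d :=
  ⟨straightWalk 1 1, ⟨le_rfl, by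
    have hy : ∀ k, yCoord ((straightWalk (1 : Fin d) 1).path k) = (min k 1 : ℕ) := fun k => by
      simp [yCoord, straightWalk]
    refine ⟨zero_le, fun i _ hi => (straightWalk 1 1).adj i hi,
      (straightWalk_mem_SAW 1 1).2.2.mono fun i hi => hi.2, fun j hj => ?_, fun j hj => ?_⟩
    · rw [hy, hy]
      have := hj.1
      omega
    · rw [hy, hy]
      have := hj.2
      change j ≤ 1 at this
      change ((min j 1 : ℕ) : ℤ) ≤ ((min 1 1 : ℕ) : ℤ)
      omega, fun k hk hk' => by
    change k + 1 ≤ 1 at hk'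
    omega⟩, (straightWalk_mem_SAW 1 1).2.1⟩

theorem tilt_upBlock_path (hd : 2 ≤ d) (σ : ℤ) (k : ℕ) :
    tilt σ ((upBlock d).path k) = (min k 1 : ℕ) := by
  have h01 : (0 : Fin d) ≠ 1 := by
    obtain ⟨n, rfl⟩ := Nat.exists_eq_add_of_le' hd
    exact Fin.zero_ne_one
  change tilt σ (Pi.single 1 ((min k 1 : ℕ) : ℤ)) = _
  simp [tilt, yCoord, xCoord, Pi.single_eq_of_ne h01]

theorem tilt_upBlock_disp (hd : 2 ≤ d) (σ : ℤ) : tilt σ (upBlock d).disp = 1 :=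
  tilt_upBlock_path hd σ 1

open Classical in
/-- A bound on the distance by which a block leaves the cone spanned by its end points. -/
noncomputable def ISAB.margin (γ : ISAB d) : ℤ := if γ = upBlock d then 0 else 2 * γ.length

-- The value zero is essential: at k = 0 the condition `InCone` compares the margin of the first
-- block with an empty sum.
@[simp] theorem margin_upBlock : (upBlock d).margin = 0 := if_pos rfl

theorem ISAB.margin_le (γ : ISAB d) : γ.margin ≤ 2 * γ.length := by
  unfold ISAB.margin
  split_ifs
  · positivity
  · exact le_rfl

theorem ISAB.neg_margin_le_tilt (γ : ISAB d) (hd : 2 ≤ d) {σ : ℤ} (hσ : |σ| = 1) {j : ℕ}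
    (hj : j ≤ γ.length) : -γ.margin ≤ tilt σ (γ.path j) := by
  by_cases h : γ = upBlock d
  · rw [h, margin_upBlock, tilt_upBlock_path hd]; positivity
  · rw [ISAB.margin, if_neg h]
    have := γ.abs_tilt_sub_le hσ (zero_le : 0 ≤ j) hj
    rw [γ.path_zero, tilt_zero, sub_zero] at this
    exact (abs_le.1 this).1

theorem ISAB.tilt_sub_margin_le (γ : ISAB d) (hd : 2 ≤ d) {σ : ℤ} (hσ : |σ| = 1) {j : ℕ}
    (hj : j ≤ γ.length) : tilt σ (γ.path j) - γ.margin ≤ tilt σ γ.disp := by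
  by_cases h : γ = upBlock d
  · rw [h, margin_upBlock, tilt_upBlock_path hd, tilt_upBlock_disp hd]; omega
  · rw [ISAB.margin, if_neg h]
    have := γ.abs_tilt_sub_le hσ hj le_rfl
    have := (abs_le.1 this).1
    unfold ISAB.disp
    omega

theorem isBridgeOn_reflect_zero (hd : 2 ≤ d) {γ : ℕ → Lattice d} {a b : ℕ}
    (h : IsBridgeOn γ a b) : IsBridgeOn (fun k => reflect 0 (γ k)) a b := by
  have h01 : (1 : Fin d) ≠ 0 := by
    obtain ⟨n, rfl⟩ := Nat.exists_eq_add_of_le' hd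
    exact Fin.zero_ne_one.symm
  have hy : ∀ u : Lattice d, yCoord (reflect 0 u) = yCoord u := fun u => reflect_ne u h01
  obtain ⟨hab, h1, h2, h3, h4⟩ := h
  refine ⟨hab, fun i hi hi' => adj_reflect (h1 i hi hi'), fun i hi j hj hij =>
    h2 hi hj (reflect_injective _ hij), fun j hj => ?_, fun j hj => ?_⟩
  · rw [hy, hy]; exact h3 j hj
  · rw [hy, hy]; exact h4 j hj

/-- The reflection of the first coordinate on irreducible bridges. -/
def ISAB.reflX (hd : 2 ≤ d) : ISAB d ≃ ISAB d :=
  Function.Involutive.toPerm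
    (fun γ => ⟨γ.1.refl 0, ⟨⟨γ.2.1.1, isBridgeOn_reflect_zero hd γ.2.1.2.1, fun k hk hk' h =>
      γ.2.1.2.2 k hk hk' (by
        have h1 := isBridgeOn_reflect_zero hd h.1
        have h2 := isBridgeOn_reflect_zero hd h.2
        simp only [FinWalk.refl, reflect_reflect] at h1 h2
        exact ⟨h1, h2⟩)⟩, by
      change reflect 0 (γ.1.path 0) = 0
      rw [γ.2.2, reflect_zero]⟩⟩)
    fun γ => Subtype.ext (FinWalk.refl_refl 0 γ.1)

/-- The weight of a bridge depends only on its length, which reflection preserves. -/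
theorem map_reflX (hd : 2 ≤ d) : (iSABLaw d).map (ISAB.reflX hd) = iSABLaw d := by
  ext s hs
  rw [Measure.map_apply measurable_from_top hs, iSABLaw_apply_eq_tsum, iSABLaw_apply_eq_tsum]
  exact (ISAB.reflX hd).tsum_eq fun γ => criticalPoint d ^ γ.length * s.indicator 1 γ

theorem measurable_isab {β : Type*} [MeasurableSpace β] (f : ISAB d → β) : Measurable f :=
  measurable_from_top

theorem integrable_length (hmean : ∫⁻ γ, (γ.length : ℝ≥0∞) ∂(iSABLaw d) < ⊤) :
    Integrable (fun γ : ISAB d => (γ.length : ℝ)) (iSABLaw d) := by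
  refine ⟨(measurable_isab _).aestronglyMeasurable, ?_⟩
  simpa [HasFiniteIntegral, enorm_eq_nnnorm] using hmean

theorem integrable_tilt_disp (hmean : ∫⁻ γ, (γ.length : ℝ≥0∞) ∂(iSABLaw d) < ⊤)
    {σ : ℤ} (hσ : |σ| = 1) :
    Integrable (fun γ : ISAB d => (tilt σ γ.disp : ℝ)) (iSABLaw d) := by
  refine ((integrable_length hmean).const_mul 2).mono'
    (measurable_isab _).aestronglyMeasurable (Eventually.of_forall fun γ => ?_)
  rw [Real.norm_eq_abs]
  exact_mod_cast γ.abs_tilt_disp_le hσ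

/-- By reflection symmetry y + σx and y - σx have the same mean, and they add up to 2y, which is
positive on every block. -/
theorem integral_tilt_disp_pos (hmean : ∫⁻ γ, (γ.length : ℝ≥0∞) ∂(iSABLaw d) < ⊤)
    (hd : 2 ≤ d) {σ : ℤ} (hσ : |σ| = 1) :
    0 < ∫ γ, (tilt σ γ.disp : ℝ) ∂(iSABLaw d) := by
  have h01 : (1 : Fin d) ≠ 0 := by
    obtain ⟨n, rfl⟩ := Nat.exists_eq_add_of_le' hd
    exact Fin.zero_ne_one.symm
  have hsymm : ∫ γ, (tilt σ γ.disp : ℝ) ∂(iSABLaw d) =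
      ∫ γ, (tilt (-σ) γ.disp : ℝ) ∂(iSABLaw d) := by
    conv_lhs => rw [← map_reflX hd]
    rw [integral_map (measurable_isab _).aemeasurable (measurable_isab _).aestronglyMeasurable]
    refine integral_congr_ae (Eventually.of_forall fun γ => ?_)
    have : ((ISAB.reflX hd) γ).disp = reflect 0 γ.disp := rfl
    simp [this, tilt, yCoord, xCoord, reflect_same, reflect_ne _ h01]
  have hint := integrable_tilt_disp hmean hσ
  have hint' := integrable_tilt_disp hmean (σ := -σ) (by rwa [abs_neg])
  have h2 : (1 : ℝ) ≤ ∫ γ, ((tilt σ γ.disp : ℝ) + (tilt (-σ) γ.disp : ℝ)) ∂(iSABLaw d) := by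
    have h1 : ∫ _ : ISAB d, (1 : ℝ) ∂(iSABLaw d) = 1 := by simp
    rw [← h1]
    refine integral_mono (integrable_const _) (hint.add hint') fun γ => ?_
    have := γ.one_le_yCoord_disp
    have e : (1 : ℤ) ≤ tilt σ γ.disp + tilt (-σ) γ.disp := by
      simp only [tilt]; linarith
    have e' : (1 : ℝ) ≤ (tilt σ γ.disp : ℝ) + (tilt (-σ) γ.disp : ℝ) := by exact_mod_cast e
    exact e'
  rw [integral_add hint hint', ← hsymm] at h2
  linarith

end Block

/-! ### Laws of large numbers -/

section SLLN

variable {X : Type*} [MeasurableSpace X] (ν : Measure X) [IsProbabilityMeasure ν]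

/-- The strong law of large numbers on the product space. -/
theorem ae_tendsto_average {f : X → ℝ} (hfm : Measurable f) (hf : Integrable f ν) :
    ∀ᵐ η ∂(Measure.infinitePi fun _ : ℕ => ν),
      Tendsto (fun n : ℕ => (∑ i ∈ Finset.range n, f (η i)) / n) atTop
        (nhds (∫ x, f x ∂ν)) := by
  have hmp : ∀ i : ℕ, MeasurePreserving (fun η : ℕ → X => η i)
      (Measure.infinitePi fun _ : ℕ => ν) ν := fun i =>
    measurePreserving_eval_infinitePi (fun _ : ℕ => ν) i
  have h := ProbabilityTheory.strong_law_ae_real (μ := Measure.infinitePi fun _ : ℕ => ν)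
    (fun (i : ℕ) (η : ℕ → X) => f (η i)) ((hmp 0).integrable_comp_of_integrable hf)
    (fun i j hij => (ProbabilityTheory.iIndepFun_infinitePi (P := fun _ : ℕ => ν)
      (X := fun _ => f) fun _ => hfm).indepFun hij)
    (fun i => ?_)
  · have e : ∫ η, f (η 0) ∂(Measure.infinitePi fun _ : ℕ => ν) = ∫ x, f x ∂ν := by
      rw [← (hmp 0).map_eq, integral_map (hmp 0).aemeasurable hfm.aestronglyMeasurable,
        (hmp 0).map_eq]
    rwa [e] at h
  · refine ⟨(hfm.comp (measurable_pi_apply i)).aemeasurable,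
      (hfm.comp (measurable_pi_apply 0)).aemeasurable, ?_⟩
    have e : ∀ j, (Measure.infinitePi fun _ : ℕ => ν).map (fun η : ℕ → X => f (η j)) =
        ν.map f := fun j => by
      conv_rhs => rw [← (hmp j).map_eq]
      rw [Measure.map_map hfm (measurable_pi_apply j)]
      rfl
    rw [e, e]

end SLLN

/-- Convergence of the averages of L forces L k = o(k), while the sums of X grow linearly. The
finitely many early terms are absorbed in M. -/
theorem exists_forall_le_of_tendsto_average {X L : ℕ → ℝ} {v l : ℝ} (hv : 0 < v)
    (hX : Tendsto (fun n : ℕ => (∑ i ∈ Finset.range n, X i) / n) atTop (nhds v))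
    (hL : Tendsto (fun n : ℕ => (∑ i ∈ Finset.range n, L i) / n) atTop (nhds l)) :
    ∃ M : ℕ, ∀ k, 2 * L k - M ≤ ∑ i ∈ Finset.range k, X i := by
  -- The tolerance v/5 is chosen so that, from the two bounds on the sums of L, 2 L k < 2l + 2v/5 +
  -- (4v/5)k, whose slope is exactly that of the lower bound (v - v/5)k for the sums of X.
  have hX' := hX.eventually_const_lt (show v - v / 5 < v by linarith)
  have hL1 := hL.eventually_const_lt (show l - v / 5 < l by linarith)
  have hL2 := hL.eventually_lt_const (show l < l + v / 5 by linarith)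
  obtain ⟨N, hN⟩ := eventually_atTop.1 (((hX'.and hL1).and hL2).and (eventually_ge_atTop 1))
  obtain ⟨M, hM⟩ := exists_nat_ge (max (2 * l + 2 * (v / 5))
    (∑ k ∈ Finset.range N, |2 * L k - ∑ i ∈ Finset.range k, X i|))
  refine ⟨M, fun k => ?_⟩
  rcases lt_or_ge k N with hk | hk
  · have h1 := Finset.single_le_sum (f := fun k => |2 * L k - ∑ i ∈ Finset.range k, X i|)
      (fun _ _ => abs_nonneg _) (Finset.mem_range.2 hk)
    have h2 := le_abs_self (2 * L k - ∑ i ∈ Finset.range k, X i)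
    have h3 := (le_max_right _ _).trans hM
    linarith
  · obtain ⟨⟨⟨a1, a2⟩, -⟩, a4⟩ := hN k hk
    obtain ⟨⟨-, b3⟩, -⟩ := hN (k + 1) (by omega)
    have hk0 : (0 : ℝ) < k := by exact_mod_cast a4
    have hk1 : (0 : ℝ) < (k + 1 : ℕ) := by positivity
    rw [lt_div_iff₀ hk0] at a1 a2
    rw [div_lt_iff₀ hk1, Finset.sum_range_succ] at b3
    push_cast at b3
    have h3 := (le_max_left _ _).trans hM
    nlinarith

/-! ### Positive probability of a diamond point -/

section Cone

variable {d : ℕ} [NeZero d]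

/-- The walk built from the blocks `η` leaves the cones `y ± x ≥ 0` by at most `M`, with room for
the excursion of each block. -/
def AlmostInCone (M : ℕ) (η : ℕ → ISAB d) : Prop :=
  ∀ σ : ℤ, |σ| = 1 → ∀ k, 2 * ((η k).length : ℤ) - M ≤ ∑ i ∈ Finset.range k, tilt σ (η i).disp

/-- The walk built from the blocks `η`, traversed in either direction, stays in the cones
`y ± x ≥ 0`. -/
def InCone (η : ℕ → ISAB d) : Prop :=
  ∀ σ : ℤ, |σ| = 1 → ∀ k, (η k).margin ≤ ∑ i ∈ Finset.range k, tilt σ (η i).disp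

/-- The initial M blocks have margin zero and raise both tilts by M, which pays for the defect M of
the rest. -/
theorem inCone_of_almostInCone (hd : 2 ≤ d) {M : ℕ} {η : ℕ → ISAB d}
    (hup : ∀ i < M, η i = upBlock d) (h : AlmostInCone M fun k => η (M + k)) : InCone η := by
  intro σ hσ k
  have hsum : ∀ k ≤ M, ∑ i ∈ Finset.range k, tilt σ (η i).disp = k := fun k hk => by
    rw [Finset.sum_congr rfl fun i hi => by
      rw [hup i ((Finset.mem_range.1 hi).trans_le hk), tilt_upBlock_disp hd]]
    simp
  rcases lt_or_ge k M with hk | hk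
  · rw [hup k hk, margin_upBlock, hsum k hk.le]; positivity
  · obtain ⟨j, rfl⟩ := Nat.exists_eq_add_of_le hk
    rw [Finset.sum_range_add, hsum M le_rfl]
    have h1 := h σ hσ j
    have h2 := (η (M + j)).margin_le
    linarith

theorem measurableSet_almostInCone (M : ℕ) : MeasurableSet {η : ℕ → ISAB d | AlmostInCone M η} := by
  have : {η : ℕ → ISAB d | AlmostInCone M η} = ⋂ σ : ℤ, ⋂ _ : |σ| = 1, ⋂ k : ℕ,
      {η | 2 * ((η k).length : ℤ) - M ≤ ∑ i ∈ Finset.range k, tilt σ (η i).disp} := by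
    ext; simp [AlmostInCone]
  rw [this]
  refine .iInter fun σ => .iInter fun _ => .iInter fun k => measurableSet_le ?_ ?_
  · exact (measurable_isab fun γ : ISAB d => 2 * (γ.length : ℤ) - M).comp (measurable_pi_apply k)
  · exact Finset.measurable_sum _ fun i _ =>
      (measurable_isab fun γ : ISAB d => tilt σ γ.disp).comp (measurable_pi_apply i)

theorem measurableSet_inCone : MeasurableSet {η : ℕ → ISAB d | InCone η} := by
  have : {η : ℕ → ISAB d | InCone η} = ⋂ σ : ℤ, ⋂ _ : |σ| = 1, ⋂ k : ℕ,
      {η | (η k).margin ≤ ∑ i ∈ Finset.range k, tilt σ (η i).disp} := by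
    ext; simp [InCone]
  rw [this]
  refine .iInter fun σ => .iInter fun _ => .iInter fun k => measurableSet_le ?_ ?_
  · exact (measurable_isab fun γ : ISAB d => γ.margin).comp (measurable_pi_apply k)
  · exact Finset.measurable_sum _ fun i _ =>
      (measurable_isab fun γ : ISAB d => tilt σ γ.disp).comp (measurable_pi_apply i)

/-- Almost surely some finite defect M works for both signs, so the countable union over M has full
measure and some member is not null. -/
theorem exists_almostInCone_pos (hd : 2 ≤ d)
    (hmean : ∫⁻ γ, (γ.length : ℝ≥0∞) ∂(iSABLaw d) < ⊤) :
    ∃ M : ℕ, 0 < Measure.infinitePi (fun _ : ℕ => iSABLaw d) {η | AlmostInCone M η} := by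
  have hae : ∀ σ : ℤ, |σ| = 1 → ∀ᵐ η ∂(Measure.infinitePi fun _ : ℕ => iSABLaw d), ∃ M : ℕ,
      ∀ k, 2 * ((η k).length : ℤ) - M ≤ ∑ i ∈ Finset.range k, tilt σ (η i).disp := by
    intro σ hσ
    filter_upwards [ae_tendsto_average (iSABLaw d) (measurable_isab _)
      (integrable_tilt_disp hmean hσ), ae_tendsto_average (iSABLaw d) (measurable_isab _)
      (integrable_length hmean)] with η h1 h2
    obtain ⟨M, hM⟩ :=
      exists_forall_le_of_tendsto_average (integral_tilt_disp_pos hmean hd hσ) h1 h2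
    exact ⟨M, fun k => by exact_mod_cast hM k⟩
  have hae' : ∀ᵐ η ∂(Measure.infinitePi fun _ : ℕ => iSABLaw d), ∃ M : ℕ, AlmostInCone M η := by
    filter_upwards [hae 1 (by simp), hae (-1) (by simp)] with η h1 h2
    obtain ⟨M, hM⟩ := h1
    obtain ⟨M', hM'⟩ := h2
    refine ⟨max M M', fun σ hσ k => ?_⟩
    have a1 : (M : ℤ) ≤ (max M M' : ℕ) := by exact_mod_cast le_max_left _ _
    have a2 : (M' : ℤ) ≤ (max M M' : ℕ) := by exact_mod_cast le_max_right _ _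
    rcases eq_or_eq_neg_of_abs_eq hσ with rfl | rfl
    · exact (sub_le_sub_left a1 _).trans (hM k)
    · exact (sub_le_sub_left a2 _).trans (hM' k)
  by_contra! h
  have hnull : Measure.infinitePi (fun _ : ℕ => iSABLaw d)
      (⋃ M : ℕ, {η | AlmostInCone M η}) = 0 :=
    measure_iUnion_null fun M => le_antisymm (h M) zero_le
  have hfull : Measure.infinitePi (fun _ : ℕ => iSABLaw d)
      (⋃ M : ℕ, {η | AlmostInCone M η}) = 1 := by
    have : (⋃ M : ℕ, {η : ℕ → ISAB d | AlmostInCone M η}) = {η | ∃ M : ℕ, AlmostInCone M η} := by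
      ext; simp
    rw [this]
    rw [measure_congr (eventuallyEq_univ.2 hae'), measure_univ]
  exact zero_ne_one (hnull.symm.trans hfull)

variable (d) in
/-- The two-sided sequences of blocks for which the time `0` is a diamond point. -/
def diamondSet : Set (ℤ → ISAB d) :=
  {ω | InCone (fun k : ℕ => ω k) ∧ InCone fun k : ℕ => ω (-1 - k)}

theorem measurableSet_diamondSet : MeasurableSet (diamondSet d) := by
  have h : ∀ f : ℕ → ℤ, Measurable fun (ω : ℤ → ISAB d) (k : ℕ) => ω (f k) := fun f =>
    measurable_pi_lambda _ fun k => measurable_pi_apply _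
  exact (h (fun k => k) measurableSet_inCone).inter (h (fun k => -1 - k) measurableSet_inCone)

/-- The three constraints concern the disjoint index sets [-M, M), [M, ∞) and (-∞, -M), so their
probabilities multiply. Each is positive. -/
theorem measure_diamondSet_pos (hd : 2 ≤ d)
    (hmean : ∫⁻ γ, (γ.length : ℝ≥0∞) ∂(iSABLaw d) < ⊤) :
    0 < Measure.infinitePi (fun _ : ℤ => iSABLaw d) (diamondSet d) := by
  obtain ⟨M, hM⟩ := exists_almostInCone_pos hd hmean
  set μ := Measure.infinitePi fun _ : ℤ => iSABLaw d
  let I : Finset ℤ := Finset.Ico (-M) M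
  let U : Set (ℤ → ISAB d) := cylinder (α := fun _ => ISAB d) I {ω | ∀ i, ω i = upBlock d}
  let A : Set (ℤ → ISAB d) := (fun ω (k : ℕ) => ω (M + k)) ⁻¹' {η | AlmostInCone M η}
  let B : Set (ℤ → ISAB d) := (fun ω (k : ℕ) => ω (-1 - (M + k))) ⁻¹' {η | AlmostInCone M η}
  have hsub : U ∩ (A ∩ B) ⊆ diamondSet d := by
    rintro ω ⟨hU, hA, hB⟩
    have hU' : ∀ i : ℤ, -M ≤ i → i < M → ω i = upBlock d := fun i h1 h2 =>
      hU ⟨i, Finset.mem_Ico.2 ⟨h1, h2⟩⟩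
    refine ⟨inCone_of_almostInCone hd (M := M) (fun i hi => hU' _ (by omega) (by omega)) ?_,
      inCone_of_almostInCone hd (M := M) (fun i hi => hU' _ (by omega) (by omega)) ?_⟩
    · simpa [A] using hA
    · simpa [B] using hB
  have hmeas : ∀ (f : ℕ → ℤ) (S : Set ℤ), (∀ k, f k ∈ S) →
      MeasurableSet[cylinderEvents (X := fun _ => ISAB d) S]
        ((fun ω (k : ℕ) => ω (f k)) ⁻¹' {η : ℕ → ISAB d | AlmostInCone M η}) := fun f S hf => by
    have : Measurable[cylinderEvents (X := fun _ => ISAB d) S]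
        (fun (ω : ℤ → ISAB d) (k : ℕ) => ω (f k)) :=
      @measurable_pi_lambda _ _ _ (_) _ _ fun k =>
        measurable_cylinderEvent_apply (X := fun _ => ISAB d) (hf k)
    exact this (measurableSet_almostInCone M)
  have hA := hmeas (fun k => M + k) (Set.Ici M) fun k => by simp
  have hB := hmeas (fun k => -1 - (M + k)) (Set.Iio (-M)) fun k => by
    simp only [Set.mem_Iio]; omega
  have hfin : MeasurableSet {ω : I → ISAB d | ∀ i, ω i = upBlock d} := by
    have : {ω : I → ISAB d | ∀ i, ω i = upBlock d} =
        ⋂ i, (fun ω : I → ISAB d => ω i) ⁻¹' {upBlock d} := by ext; simp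
    rw [this]
    exact .iInter fun i => measurable_pi_apply i MeasurableSpace.measurableSet_top
  have hU := measurableSet_cylinderEvents_cylinder I hfin
  have e1 : μ (A ∩ B) = μ A * μ B := by
    refine measure_inter_cylinderEvents _ ?_ hA hB
    rw [Set.disjoint_left]
    intro i hi hi'
    simp only [Set.mem_Ici, Set.mem_Iio] at hi hi'
    omega
  have e2 : μ (U ∩ (A ∩ B)) = μ U * μ (A ∩ B) := by
    refine measure_inter_cylinderEvents _ (S' := Set.Ici (M : ℤ) ∪ Set.Iio (-M)) ?_ hU
      ((cylinderEvents_mono Set.subset_union_left _ hA).inter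
        (cylinderEvents_mono Set.subset_union_right _ hB))
    rw [Set.disjoint_left]
    intro i hi hi'
    simp only [I, Finset.coe_Ico, Set.mem_Ico, Set.mem_union, Set.mem_Ici, Set.mem_Iio] at hi hi'
    omega
  have hApos : 0 < μ A := by
    rw [(measurePreserving_reindex (iSABLaw d) (f := fun k : ℕ => (M : ℤ) + k) fun a b h => by
      simpa using h).measure_preimage (measurableSet_almostInCone M).nullMeasurableSet]
    exact hM
  have hBpos : 0 < μ B := by
    rw [(measurePreserving_reindex (iSABLaw d) (f := fun k : ℕ => -1 - ((M : ℤ) + k)) fun a b h => by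
      simpa using h).measure_preimage (measurableSet_almostInCone M).nullMeasurableSet]
    exact hM
  have hUpos : 0 < μ U := by
    have : U = Set.pi (I : Set ℤ) fun _ => {upBlock d} := by
      ext ω; simp [U, mem_cylinder]
    rw [this, Measure.infinitePi_pi _ fun _ _ => MeasurableSpace.measurableSet_top]
    exact CanonicallyOrderedAdd.prod_pos.2 fun _ _ => iSABLaw_singleton_pos d _
  refine lt_of_lt_of_le ?_ (measure_mono hsub)
  rw [e2, e1]
  exact ENNReal.mul_pos hUpos.ne' (ENNReal.mul_pos hApos.ne' hBpos.ne').ne'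

end Cone

/-! ### Renewal and diamond times of the concatenation -/

section Concat

variable {d : ℕ} [NeZero d]

theorem blockStart_succ (ξ : ℕ → ISAB d) (n : ℕ) :
    blockStart ξ (n + 1) = blockStart ξ n + (ξ n).length :=
  Finset.sum_range_succ _ _

theorem blockStart_strictMono (ξ : ℕ → ISAB d) : StrictMono (blockStart ξ) :=
  strictMono_nat_of_lt_succ fun n => by
    have := (ξ n).one_le_length
    rw [blockStart_succ]
    omega

/-- Every time belongs to a block. -/
theorem exists_eq_blockStart_add (ξ : ℕ → ISAB d) (t : ℕ) :
    ∃ n j, t = blockStart ξ n + j ∧ j < (ξ n).length := by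
  induction t with
  | zero => exact ⟨0, 0, by simp [blockStart], (ξ 0).one_le_length⟩
  | succ t ih =>
    obtain ⟨n, j, rfl, hj⟩ := ih
    rcases Nat.lt_or_ge (j + 1) (ξ n).length with h | h
    · exact ⟨n, j + 1, by omega, h⟩
    · exact ⟨n + 1, 0, by rw [blockStart_succ]; omega, (ξ (n + 1)).one_le_length⟩

theorem concat_blockStart (ξ : ℕ → ISAB d) (n : ℕ) :
    concat ξ (blockStart ξ n) = ∑ i ∈ Finset.range n, (ξ i).disp := by
  have := concat_blockStart_add ξ n 0 zero_le
  rwa [ISAB.path_zero, add_zero, add_zero] at this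

theorem isBridgeOn_concat_iff (ξ : ℕ → ISAB d) {n a b : ℕ} (hb : b ≤ (ξ n).length) :
    IsBridgeOn (concat ξ) (blockStart ξ n + a) (blockStart ξ n + b) ↔
      IsBridgeOn (ξ n).path a b := by
  by_cases hab : a ≤ b
  · obtain ⟨m, rfl⟩ := Nat.exists_eq_add_of_le hab
    rw [← add_assoc]
    refine (isBridgeOn_shift (∑ i ∈ Finset.range n, (ξ i).disp) fun k hk => ?_).symm
    rw [add_assoc, concat_blockStart_add ξ n (a + k) (by omega), add_comm]
    rfl
  · exact ⟨fun h => absurd h.1 (by omega), fun h => absurd h.1 hab⟩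

theorem isBridgeOn_concat_blockStart (ξ : ℕ → ISAB d) {m n : ℕ} (h : m ≤ n) :
    IsBridgeOn (concat ξ) (blockStart ξ m) (blockStart ξ n) := by
  induction n, h using Nat.le_induction with
  | base => exact isBridgeOn_refl _ _
  | succ n _ ih =>
    refine ih.trans ?_
    rw [blockStart_succ]
    exact (isBridgeOn_concat_iff ξ (a := 0) le_rfl).2 (ξ n).isBridgeOn

/-- Any finite set of times lies before some later block boundary, and between boundaries the walk
is a finite bridge. -/
theorem isInfBridgeFrom_concat_blockStart (ξ : ℕ → ISAB d) (n : ℕ) :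
    IsInfBridgeFrom (concat ξ) (blockStart ξ n) := by
  have h : ∀ j, blockStart ξ n ≤ j →
      IsBridgeOn (concat ξ) (blockStart ξ n) (blockStart ξ (j + 1)) := fun j hj =>
    isBridgeOn_concat_blockStart ξ ((le_blockStart ξ n).trans (hj.trans (Nat.le_succ j)))
  have hlt : ∀ j, j < blockStart ξ (j + 1) := fun j => le_blockStart ξ (j + 1)
  refine ⟨fun i hi => (h i hi).2.1 i hi (hlt i), fun i hi j hj hij => ?_, fun j hj => ?_⟩
  · rw [Set.mem_Ici] at hi hj
    have hm : blockStart ξ n ≤ max i j := hi.trans (le_max_left _ _)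
    have := hlt (max i j)
    exact (h _ hm).2.2.1 ⟨hi, by omega⟩ ⟨hj, by omega⟩ hij
  · rw [Set.mem_Ioi] at hj
    exact (h j hj.le).2.2.2.1 j ⟨hj, (hlt j).le⟩

/-- The renewal times of a concatenation of irreducible bridges are the starts of its blocks. -/
theorem renewalTimes_concat (ξ : ℕ → ISAB d) :
    renewalTimes (concat ξ) = Set.range (blockStart ξ) := by
  ext t
  constructor
  · rintro ⟨h1, h2⟩
    obtain ⟨n, j, rfl, hj⟩ := exists_eq_blockStart_add ξ t
    rcases Nat.eq_zero_or_pos j with rfl | hj0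
    · exact ⟨n, rfl⟩
    -- A renewal time strictly inside a block would split that irreducible bridge into two bridges.
    · refine absurd ⟨?_, ?_⟩ ((ξ n).2.1.2.2 j hj0 hj)
      · change IsBridgeOn (ξ n).path 0 j
        rw [← isBridgeOn_concat_iff ξ hj.le]
        exact h1.restrict_left zero_le (Nat.le_add_right _ _) fun i hi =>
          (isInfBridgeFrom_concat_blockStart ξ n).2.2 i hi.1
      · change IsBridgeOn (ξ n).path j (ξ n).length
        rw [← isBridgeOn_concat_iff ξ le_rfl, ← blockStart_succ]
        refine (isBridgeOn_concat_blockStart ξ (Nat.le_succ n)).restrict_left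
          (Nat.le_add_right _ _) ?_ fun i hi => h2.2.2 i hi.1
        simp only [Nat.succ_eq_add_one, blockStart_succ]
        omega
  · rintro ⟨n, rfl⟩
    exact ⟨isBridgeOn_concat_blockStart ξ (Nat.zero_le n), isInfBridgeFrom_concat_blockStart ξ n⟩

theorem renewalIndex_concat (ξ : ℕ → ISAB d) (n : ℕ) :
    renewalIndex (concat ξ) n = blockStart ξ n := by
  induction n with
  | zero => rfl
  | succ n ih =>
    rw [renewalIndex, ih, renewalTimes_concat]
    refine IsLeast.csInf_eq ⟨⟨blockStart_strictMono ξ (Nat.lt_succ_self n), n + 1, rfl⟩, ?_⟩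
    rintro _ ⟨h, m, rfl⟩
    exact (blockStart_strictMono ξ).monotone ((blockStart_strictMono ξ).lt_iff_lt.1 h)

theorem tilt_concat (ξ : ℕ → ISAB d) (σ : ℤ) (n j : ℕ) (hj : j ≤ (ξ n).length) :
    tilt σ (concat ξ (blockStart ξ n + j)) =
      (∑ i ∈ Finset.range n, tilt σ (ξ i).disp) + tilt σ ((ξ n).path j) := by
  rw [concat_blockStart_add ξ n j hj, tilt_add, tilt_sum]
  rfl

theorem mem_diamondTimes_of_tilt {γ : ℕ → Lattice d} {t : ℕ}
    (h : ∀ σ : ℤ, |σ| = 1 → (∀ j, t ≤ j → tilt σ (γ t) ≤ tilt σ (γ j)) ∧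
      ∀ j, j ≤ t → tilt σ (γ j) ≤ tilt σ (γ t)) : t ∈ diamondTimes γ := by
  have h1 := h 1 (by simp)
  have h2 := h (-1) (by simp)
  simp only [tilt] at h1 h2
  refine ⟨fun j hj => ⟨?_, ?_⟩, fun j hj => ⟨?_, ?_⟩⟩
  · linarith [h1.1 j hj]
  · linarith [h2.1 j hj]
  · linarith [h1.2 j hj]
  · linarith [h2.2 j hj]

/-- Between the boundary n and a time t there are some complete blocks and a part of one more block.
The cone condition says that the tilts of the complete blocks outweigh the margin, which bounds the
loss on the partial block. The past is the same argument with the blocks read backwards. -/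
theorem blockStart_mem_diamondTimes (hd : 2 ≤ d) (ω : ℤ → ISAB d) (n : ℕ)
    (h : shift^[n] ω ∈ diamondSet d) :
    blockStart (fun k : ℕ => ω k) n ∈ diamondTimes (concat fun k : ℕ => ω k) := by
  rw [shift_iterate] at h
  obtain ⟨hf, hp⟩ := h
  set ξ : ℕ → ISAB d := fun k => ω k with hξ
  refine mem_diamondTimes_of_tilt fun σ hσ => ⟨fun t ht => ?_, fun t ht => ?_⟩
  all_goals
    obtain ⟨m, j, rfl, hj⟩ := exists_eq_blockStart_add ξ t
    rw [tilt_concat ξ σ m j hj.le, concat_blockStart, tilt_sum]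
  · have hnm : n ≤ m := by
      by_contra! hmn
      have := (blockStart_strictMono ξ).monotone (Nat.succ_le_of_lt hmn)
      rw [Nat.succ_eq_add_one, blockStart_succ] at this
      omega
    obtain ⟨l, rfl⟩ := Nat.exists_eq_add_of_le hnm
    have h1 := hf σ hσ l
    have h2 := (ξ (n + l)).neg_margin_le_tilt hd hσ hj.le
    have e1 : ∀ i : ℕ, ω ((i : ℤ) + n) = ξ (n + i) := fun i => by
      simp only [hξ]; congr 1; push_cast; ring
    simp only [e1] at h1
    rw [Finset.sum_range_add]
    linarith
  · rcases Nat.lt_or_ge m n with hmn | hmn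
    · obtain ⟨l, rfl⟩ := Nat.exists_eq_add_of_lt hmn
      have h1 : (ω (-1 - (l : ℤ) + (m + l + 1 : ℕ))).margin ≤
          ∑ i ∈ Finset.range l, tilt σ (ω (-1 - (i : ℤ) + (m + l + 1 : ℕ))).disp := hp σ hσ l
      have h2 := (ξ m).tilt_sub_margin_le hd hσ hj.le
      have e1 : ∀ i ∈ Finset.range l, tilt σ (ω (-1 - (i : ℤ) + (m + l + 1 : ℕ))).disp =
          tilt σ (ξ (m + 1 + (l - 1 - i))).disp := fun i hi => by
        rw [Finset.mem_range] at hi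
        simp only [hξ]; congr 3; omega
      have e2 : ω (-1 - (l : ℤ) + (m + l + 1 : ℕ)) = ξ m := by
        simp only [hξ]; congr 1; push_cast; ring
      -- The past condition lists blocks from n - 1 downwards; reversing the sum puts them in the
      -- order of the walk.
      rw [Finset.sum_congr rfl e1, e2,
        Finset.sum_range_reflect (fun i => tilt σ (ξ (m + 1 + i)).disp)] at h1
      rw [show m + l + 1 = m + 1 + l by omega, Finset.sum_range_add, Finset.sum_range_succ]
      linarith
    -- Here t is at most the start of block n yet belongs to a block of index at least n, so it is
    -- that start.
    · have hle := (blockStart_strictMono ξ).monotone hmn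
      have hmn' : m = n := by
        by_contra hne
        have := blockStart_strictMono ξ (lt_of_le_of_ne hmn (Ne.symm hne))
        omega
      subst hmn'
      have hj0 : j = 0 := by omega
      rw [hj0, ISAB.path_zero, tilt_zero, add_zero]

/-- The Birkhoff sum counts indices k < n, and distinct indices give distinct block starts. Only an
inequality holds in general, since `diamondSet` also constrains blocks before time 0 and uses crude
margins. -/
theorem le_ncard_diamond_renewal (hd : 2 ≤ d) (ω : ℤ → ISAB d) (n : ℕ) :
    birkhoffSum shift ((diamondSet d).indicator (1 : (ℤ → ISAB d) → ℝ)) n ω ≤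
      (diamondTimes (concat fun k : ℕ => ω k) ∩ renewalTimes (concat fun k : ℕ => ω k) ∩
        Set.Icc 0 (renewalIndex (concat fun k : ℕ => ω k) n)).ncard := by
  classical
  set ξ : ℕ → ISAB d := fun k => ω k
  have h1 : birkhoffSum shift ((diamondSet d).indicator (1 : (ℤ → ISAB d) → ℝ)) n ω =
      ((Finset.range n).filter fun k => shift^[k] ω ∈ diamondSet d).card := by
    rw [birkhoffSum, Finset.card_filter]
    push_cast
    exact Finset.sum_congr rfl fun k _ => by simp [Set.indicator_apply]
  rw [h1, Nat.cast_le, ← Finset.card_image_of_injective _ (blockStart_strictMono ξ).injective,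
    ← Set.ncard_coe_finset]
  refine Set.ncard_le_ncard (fun t ht => ?_) ((Set.finite_Icc _ _).inter_of_right _)
  rw [Finset.coe_image] at ht
  obtain ⟨k, hk, rfl⟩ := ht
  rw [Finset.mem_coe, Finset.mem_filter, Finset.mem_range] at hk
  refine ⟨⟨blockStart_mem_diamondTimes hd ω k hk.2, ?_⟩, zero_le, ?_⟩
  · rw [renewalTimes_concat]
    exact ⟨k, rfl⟩
  · rw [renewalIndex_concat]
    exact (blockStart_strictMono ξ).monotone hk.1.le

theorem le_liminf_of_linear_le {p : ℝ} {C : ℝ} (hp : 0 < p) {u : ℕ → ℕ}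
    (h : ∀ n : ℕ, p * n - C ≤ u n) :
    ENNReal.ofReal (p / 2) ≤ liminf (fun n : ℕ => (u n : ℝ≥0∞) / (n : ℝ≥0∞)) atTop := by
  refine le_liminf_of_le (by isBoundedDefault) ?_
  -- From n ≥ 2C/p on, C is at most half of pn. Requiring also n ≥ 1 avoids division by zero.
  obtain ⟨N, hN⟩ := exists_nat_ge (2 * C / p)
  filter_upwards [eventually_ge_atTop (max N 1)] with n hn
  have hn1 : (1 : ℝ) ≤ n := by exact_mod_cast (le_max_right _ _).trans hn
  have hnN : (N : ℝ) ≤ n := by exact_mod_cast (le_max_left _ _).trans hn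
  rw [ENNReal.le_div_iff_mul_le (Or.inl (by norm_cast at hn1 ⊢; omega))
    (Or.inl (ENNReal.natCast_ne_top n)), ← ENNReal.ofReal_natCast n,
    ← ENNReal.ofReal_natCast (u n), ← ENNReal.ofReal_mul (by positivity)]
  refine ENNReal.ofReal_le_ofReal ?_
  have h1 := h n
  have h2 := hN.trans hnN
  rw [div_le_iff₀ hp] at h2
  linarith

end Concat

end SelfAvoiding

/-! ### Conclusion -/

theorem mainTheorem9 (d : ℕ) [NeZero d] (hd : 2 ≤ d)
    (hmean : ∫⁻ γ, (γ.length : ℝ≥0∞) ∂(SelfAvoiding.iSABLaw d) < ⊤) :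
    ∃ δ : ℝ, 0 < δ ∧
      SelfAvoiding.infiniteBridgeLaw d
        {γ | ENNReal.ofReal δ ≤
          liminf (fun n : ℕ =>
            ((SelfAvoiding.diamondTimes γ ∩ SelfAvoiding.renewalTimes γ ∩
              Set.Icc 0 (SelfAvoiding.renewalIndex γ n)).ncard : ℝ≥0∞) / (n : ℝ≥0∞)) atTop} = 1 := by
  open SelfAvoiding in
  set μ := Measure.infinitePi fun _ : ℤ => iSABLaw d with hμ
  have hZm := measurableSet_diamondSet (d := d)
  -- Half the probability leaves room for `f` below to have strictly negative mean; halving once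
  -- more in δ absorbs the random constant C.
  set p : ℝ := μ.real (diamondSet d) / 2 with hp
  have hZpos : 0 < μ.real (diamondSet d) :=
    ENNReal.toReal_pos (measure_diamondSet_pos hd hmean).ne' (measure_ne_top _ _)
  have hp0 : 0 < p := half_pos hZpos
  refine ⟨p / 2, half_pos hp0, ?_⟩
  set S : Set (ℕ → Lattice d) := _
  change infiniteBridgeLaw d S = 1
  let f : (ℤ → ISAB d) → ℝ := fun ω => p - (diamondSet d).indicator (1 : (ℤ → ISAB d) → ℝ) ω
  have hind : Integrable ((diamondSet d).indicator (1 : (ℤ → ISAB d) → ℝ)) μ :=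
    (integrable_const (1 : ℝ)).indicator hZm
  have hf : Integrable f μ := (integrable_const p).sub hind
  have hfm : Measurable f := measurable_const.sub (measurable_one.indicator hZm)
  have hneg : ∫ ω, f ω ∂μ < 0 := by
    rw [integral_sub (integrable_const p) hind, integral_indicator_one hZm]
    simp only [integral_const, probReal_univ, smul_eq_mul, one_mul]
    linarith
  have hae : ∀ᵐ ω ∂μ, concat (fun k : ℕ => ω k) ∈ S := by
    filter_upwards [ae_bddAbove_birkhoffSum (ergodic_shift (iSABLaw d)) hfm hf hneg] with ω hω
    obtain ⟨C, hC⟩ := hω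
    refine le_liminf_of_linear_le (C := C) hp0 fun n => ?_
    refine le_trans ?_ (le_ncard_diamond_renewal hd ω n)
    have h1 : birkhoffSum shift f n ω ≤ C := hC ⟨n, rfl⟩
    have h2 : birkhoffSum shift f n ω =
        n * p - birkhoffSum shift ((diamondSet d).indicator (1 : (ℤ → ISAB d) → ℝ)) n ω := by
      simp [birkhoffSum, f, Finset.sum_sub_distrib]
    linarith
  have hmp := measurePreserving_reindex (iSABLaw d) (f := fun k : ℕ => (k : ℤ))
    Nat.cast_injective
  have hprob : IsProbabilityMeasure (infiniteBridgeLaw d) :=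
    Measure.isProbabilityMeasure_map measurable_concat.aemeasurable
  refine le_antisymm prob_le_one ?_
  -- Passing to an image measure can only increase the mass of a preimage, even for a set not known
  -- to be measurable, so the chain needs no measurability of `S`.
  calc (1 : ℝ≥0∞) = μ ((fun (ω : ℤ → ISAB d) (k : ℕ) => ω k) ⁻¹' (concat ⁻¹' S)) := by
        have : (fun (ω : ℤ → ISAB d) (k : ℕ) => ω k) ⁻¹' (concat ⁻¹' S) =ᵐ[μ] Set.univ :=
          eventuallyEq_univ.2 hae
        rw [measure_congr this, measure_univ]
    _ ≤ (μ.map fun (ω : ℤ → ISAB d) (k : ℕ) => ω k) (concat ⁻¹' S) :=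
        Measure.le_map_apply hmp.aemeasurable _
    _ = Measure.infinitePi (fun _ : ℕ => iSABLaw d) (concat ⁻¹' S) := by rw [hmp.map_eq]
    _ ≤ infiniteBridgeLaw d S := Measure.le_map_apply measurable_concat.aemeasurable _
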